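/- **Theorem (Levi-Civita connection of a warped foliation).** Let $(M,g)$ be a smooth Riemannian manifold (without boundary) with a smooth foliation $\mathcal F$ of dimension $p$ and codimension $q$, and let $\nabla$ be the Levi-Civita connection of $g=\langle\cdot,\cdot\rangle$. Write $\mathcal F$ also for the distribution of vectors tangent to the leaves, $\mathcal F^{\bot}$ for its $g$-orthogonal complement, and $E^{\top}$, $E^{\bot}$ for the $g$-orthogonal projections of a vector $E$ to $\mathcal F$ and $\mathcal F^{\bot}$. Let $A$ be the integrability tensor of $\mathcal F^{\bot}$, that is, the $(1,2)$-tensor field such that, for $X,Y$ orthogonal and $U$ tangent to $\mathcal F$, $$A(X,Y)=\tfrac12\left(\nabla_XY-\nabla_YX\right)^{\top}\in\mathcal F,\qquad A(X,U)\in\mathcal F^{\bot},\quad \langle A(X,U),Y\rangle=-\langle A(X,Y),U\rangle,\qquad A(U,\cdot)=0.$$ Let $f:M\to(0,\infty)$ be a smooth function that is constant along the leaves of $\mathcal F$. Let $g_f$ be the Riemannian metric with $g_f(v,w)=f^2g(v,w)$ if $v,w$ are both tangent to $\mathcal F$, and $g_f(v,w)=g(v,w)$ if at least one of $v,w$ is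 orthogonal to $\mathcal F$, and let $\nabla^f$ be the Levi-Civita connection of $g_f$. Then, for all smooth vector fields $X,Y$ orthogonal to $\mathcal F$ and $U,V$ tangent to $\mathcal F$, defined on an open subset of $M$, one has on that subset $$\nabla^f_XY=(\nabla_XY)^{\bot}+\frac1{f^2}(\nabla_XY)^{\top}-\frac{1-f^2}{f^2}A(X,Y),$$ $$\nabla^f_UV=(\nabla_UV)^{\top}+f^2(\nabla_UV)^{\bot}-\frac12\langle U,V\rangle\,\nabla f^2,$$ $$\nabla^f_XU=\nabla_XU+\frac12\frac{Xf^2}{f^2}\,U-(1-f^2)A(X,U),$$ $$\nabla^f_UX=\nabla_UX+\frac12\frac{Xf^2}{f^2}\,U-(1-f^2)A(X,U),$$ where $\nabla f^2$ is the gradient of $f^2$ with respect to $g$. -/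

import Mathlib

open Bundle
open scoped Manifold ContDiff Topology

namespace WarpedFoliation

section Bundle

variable {E : Type*} [NormedAddCommGroup E] [NormedSpace ℝ E]
  {M : Type*} [TopologicalSpace M] [ChartedSpace E M]

instance instFiniteDimensionalTangentSpace [FiniteDimensional ℝ E] (x : M) :
    FiniteDimensional ℝ (TangentSpace 𝓘(ℝ, E) x) :=
  inferInstanceAs (FiniteDimensional ℝ E)

theorem contMDiffAt_gramSchmidt {G : Type*} [NormedAddCommGroup G] [NormedSpace ℝ G]
    {V : M → Type*} [TopologicalSpace (TotalSpace G V)] [∀ x, NormedAddCommGroup (V x)]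
    [∀ x, InnerProductSpace ℝ (V x)] [FiberBundle G V] [VectorBundle ℝ G V]
    [IsContMDiffRiemannianBundle 𝓘(ℝ, E) ∞ G V] [ContMDiffVectorBundle ∞ G V 𝓘(ℝ, E)]
    {p : ℕ} {s : Fin p → (x : M) → V x} {x₀ : M}
    (hs : ∀ i, ContMDiffAt 𝓘(ℝ, E) (𝓘(ℝ, E).prod 𝓘(ℝ, G)) ∞
        (fun x => TotalSpace.mk' G x (s i x)) x₀)
    (hli : LinearIndependent ℝ (fun i => s i x₀)) (i : Fin p) :
    ContMDiffAt 𝓘(ℝ, E) (𝓘(ℝ, E).prod 𝓘(ℝ, G)) ∞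
        (fun x => TotalSpace.mk' G x (InnerProductSpace.gramSchmidt ℝ (fun i => s i x) i)) x₀ := by
  induction i using WellFoundedLT.induction with
  | ind i ih =>
    have : (fun x => TotalSpace.mk' G x (InnerProductSpace.gramSchmidt ℝ (fun i => s i x) i)) =
      (fun x => TotalSpace.mk' G x (s i x - ∑ j ∈ Finset.Iio i,
        (inner ℝ (InnerProductSpace.gramSchmidt ℝ (fun i => s i x) j) (s i x) /
          inner ℝ (InnerProductSpace.gramSchmidt ℝ (fun i => s i x) j)
            (InnerProductSpace.gramSchmidt ℝ (fun i => s i x) j)) •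
            InnerProductSpace.gramSchmidt ℝ (fun i => s i x) j)) := by
      funext x
      rw [InnerProductSpace.gramSchmidt_def]
      simp only [Submodule.starProjection_singleton, real_inner_self_eq_norm_sq]
      rfl
    rw [this]
    refine (hs i).sub_section (ContMDiffAt.sum_section fun j hj => ?_)
    have hj' := ih j (Finset.mem_Iio.1 hj)
    refine ContMDiffAt.smul_section (ContMDiffAt.div₀ (hj'.inner_bundle (hs i))
      (hj'.inner_bundle hj') ?_) hj'
    rw [inner_self_ne_zero]
    exact InnerProductSpace.gramSchmidt_ne_zero _ hli

theorem contMDiffAt_clm_of_apply {G G' : Type*} [NormedAddCommGroup G] [NormedSpace ℝ G]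
    [FiniteDimensional ℝ G] [NormedAddCommGroup G'] [NormedSpace ℝ G'] {h : M → G →L[ℝ] G'} {x₀ : M}
    (hh : ∀ v, ContMDiffAt 𝓘(ℝ, E) 𝓘(ℝ, G') ∞ (fun x => h x v) x₀) :
    ContMDiffAt 𝓘(ℝ, E) 𝓘(ℝ, G →L[ℝ] G') ∞ h x₀ := by
  have hd : Module.finrank ℝ G = Module.finrank ℝ (Fin (Module.finrank ℝ G) → ℝ) :=
    (Module.finrank_fin_fun ℝ).symm
  let e₁ := ContinuousLinearEquiv.ofFinrankEq hd
  let e₂ := (e₁.arrowCongr (1 : G' ≃L[ℝ] G')).trans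
    (ContinuousLinearEquiv.piRing (Fin (Module.finrank ℝ G)))
  have : h = e₂.symm ∘ (e₂ ∘ h) := by funext x; simp
  rw [this]
  exact e₂.symm.contDiff.contMDiff.contMDiffAt.comp x₀ (contMDiffAt_pi_space.2 fun i => hh _)

theorem starProjection_eq_sum_gramSchmidtNormed {W : Type*} [NormedAddCommGroup W]
    [InnerProductSpace ℝ W] {K : Submodule ℝ W} [K.HasOrthogonalProjection] {p : ℕ}
    {s : Fin p → W} (hli : LinearIndependent ℝ s) (hK : Submodule.span ℝ (Set.range s) = K)
    (v : W) :
    K.starProjection v = ∑ i, inner ℝ (InnerProductSpace.gramSchmidtNormed ℝ s i) v •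
      InnerProductSpace.gramSchmidtNormed ℝ s i := by
  have ho := InnerProductSpace.gramSchmidtNormed_orthonormal (𝕜 := ℝ) hli
  have hsp : Submodule.span ℝ (Set.range (InnerProductSpace.gramSchmidtNormed ℝ s)) = K := by
    rw [InnerProductSpace.span_gramSchmidtNormed_range, InnerProductSpace.span_gramSchmidt, hK]
  refine Submodule.eq_starProjection_of_mem_of_inner_eq_zero ?_ ?_
  · rw [← hsp]
    exact Submodule.sum_mem _ fun i _ => Submodule.smul_mem _ _ (Submodule.subset_span ⟨i, rfl⟩)
  · intro w hw
    rw [← hsp] at hw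
    induction hw using Submodule.span_induction with
    | mem w hw =>
      obtain ⟨j, rfl⟩ := hw
      have := ho.inner_left_fintype
        (fun i => inner ℝ (InnerProductSpace.gramSchmidtNormed ℝ s i) v) j
      rw [inner_sub_left, this]
      simp [real_inner_comm]
    | zero => simp
    | add a b _ _ ha hb => rw [inner_add_right, ha, hb, add_zero]
    | smul c a _ ha => rw [inner_smul_right, ha, mul_zero]

theorem exists_orthonormal_frame {G : Type*} [NormedAddCommGroup G] [NormedSpace ℝ G]
    {V : M → Type*} [TopologicalSpace (TotalSpace G V)] [∀ x, NormedAddCommGroup (V x)]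
    [∀ x, InnerProductSpace ℝ (V x)] [FiberBundle G V] [VectorBundle ℝ G V]
    [IsContMDiffRiemannianBundle 𝓘(ℝ, E) ∞ G V] [ContMDiffVectorBundle ∞ G V 𝓘(ℝ, E)]
    {K : (x : M) → Submodule ℝ (V x)} [∀ x, (K x).HasOrthogonalProjection]
    {p : ℕ} {s : Fin p → (x : M) → V x} {x₀ : M}
    (hs : ∀ i, ContMDiffAt 𝓘(ℝ, E) (𝓘(ℝ, E).prod 𝓘(ℝ, G)) ∞
        (fun x => TotalSpace.mk' G x (s i x)) x₀)
    (hspan : ∀ᶠ x in 𝓝 x₀, LinearIndependent ℝ (fun i => s i x) ∧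
        Submodule.span ℝ (Set.range fun i => s i x) = K x) :
    ∃ o : Fin p → (x : M) → V x,
      (∀ i, ContMDiffAt 𝓘(ℝ, E) (𝓘(ℝ, E).prod 𝓘(ℝ, G)) ∞
        (fun x => TotalSpace.mk' G x (o i x)) x₀) ∧
      ∀ᶠ x in 𝓝 x₀, ∀ v, (K x).starProjection v = ∑ i, inner ℝ (o i x) v • o i x := by
  have h0 := hspan.self_of_nhds.1
  have hg := contMDiffAt_gramSchmidt hs h0
  refine ⟨fun i x => InnerProductSpace.gramSchmidtNormed ℝ (fun i => s i x) i, fun i => ?_, ?_⟩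
  · have hne : InnerProductSpace.gramSchmidt ℝ (fun i => s i x₀) i ≠ 0 :=
      InnerProductSpace.gramSchmidt_ne_zero _ h0
    have hsm := (hg i).inner_bundle (hg i)
    have hr : ContMDiffAt 𝓘(ℝ, E) 𝓘(ℝ, ℝ) ∞ (fun x => (Real.sqrt
        (inner ℝ (InnerProductSpace.gramSchmidt ℝ (fun i => s i x) i)
          (InnerProductSpace.gramSchmidt ℝ (fun i => s i x) i)))⁻¹) x₀ := by
      have := ((Real.contDiffAt_sqrt (n := ∞) (inner_self_ne_zero (𝕜 := ℝ).2 hne)).inv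
        (Real.sqrt_ne_zero'.2 (real_inner_self_pos.2 hne))).contMDiffAt
      exact ContMDiffAt.comp (g := fun t : ℝ => (Real.sqrt t)⁻¹) x₀ this hsm
    refine (hr.smul_section (hg i)).congr_of_eventuallyEq (Filter.Eventually.of_forall fun x => ?_)
    refine congrArg (TotalSpace.mk' G x) ?_
    change _ = (√(inner ℝ (InnerProductSpace.gramSchmidt ℝ (fun i => s i x) i)
      (InnerProductSpace.gramSchmidt ℝ (fun i => s i x) i)))⁻¹ •
        InnerProductSpace.gramSchmidt ℝ (fun i => s i x) i
    rw [← norm_eq_sqrt_real_inner]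
    rfl
  · refine Filter.Eventually.mono hspan fun x hx => ?_
    intro v
    exact starProjection_eq_sum_gramSchmidtNormed (W := V x) (K := K x) (s := fun i => s i x) hx.1 hx.2 v

theorem contMDiffAt_starProjection_of_frame {G : Type*} [NormedAddCommGroup G] [NormedSpace ℝ G]
    {V : M → Type*} [TopologicalSpace (TotalSpace G V)] [∀ x, NormedAddCommGroup (V x)]
    [∀ x, InnerProductSpace ℝ (V x)] [FiberBundle G V] [VectorBundle ℝ G V]
    [IsContMDiffRiemannianBundle 𝓘(ℝ, E) ∞ G V] [ContMDiffVectorBundle ∞ G V 𝓘(ℝ, E)]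
    {K : (x : M) → Submodule ℝ (V x)} [∀ x, (K x).HasOrthogonalProjection]
    {p : ℕ} {o : Fin p → (x : M) → V x} {x₀ : M}
    (ho : ∀ i, ContMDiffAt 𝓘(ℝ, E) (𝓘(ℝ, E).prod 𝓘(ℝ, G)) ∞
        (fun x => TotalSpace.mk' G x (o i x)) x₀)
    (hP : ∀ᶠ x in 𝓝 x₀, ∀ v, (K x).starProjection v = ∑ i, inner ℝ (o i x) v • o i x)
    {σ : (x : M) → V x}
    (hσ : ContMDiffAt 𝓘(ℝ, E) (𝓘(ℝ, E).prod 𝓘(ℝ, G)) ∞ (fun x => TotalSpace.mk' G x (σ x)) x₀) :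
    ContMDiffAt 𝓘(ℝ, E) (𝓘(ℝ, E).prod 𝓘(ℝ, G)) ∞
      (fun x => TotalSpace.mk' G x ((K x).starProjection (σ x))) x₀ := by
  have h : ContMDiffAt 𝓘(ℝ, E) (𝓘(ℝ, E).prod 𝓘(ℝ, G)) ∞
      (fun x => TotalSpace.mk' G x (∑ i, inner ℝ (o i x) (σ x) • o i x)) x₀ :=
    ContMDiffAt.sum_section fun i _ => ((ho i).inner_bundle hσ).smul_section (ho i)
  refine h.congr_of_eventuallyEq ?_
  filter_upwards [hP] with x hx
  rw [hx]

theorem mdifferentiableAt_starProjection_of_frame {G : Type*} [NormedAddCommGroup G] [NormedSpace ℝ G]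
    {V : M → Type*} [TopologicalSpace (TotalSpace G V)] [∀ x, NormedAddCommGroup (V x)]
    [∀ x, InnerProductSpace ℝ (V x)] [FiberBundle G V] [VectorBundle ℝ G V]
    [IsContMDiffRiemannianBundle 𝓘(ℝ, E) ∞ G V] [ContMDiffVectorBundle ∞ G V 𝓘(ℝ, E)]
    {K : (x : M) → Submodule ℝ (V x)} [∀ x, (K x).HasOrthogonalProjection]
    {p : ℕ} {o : Fin p → (x : M) → V x} {x₀ : M}
    (ho : ∀ i, ContMDiffAt 𝓘(ℝ, E) (𝓘(ℝ, E).prod 𝓘(ℝ, G)) ∞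
        (fun x => TotalSpace.mk' G x (o i x)) x₀)
    (hP : ∀ᶠ x in 𝓝 x₀, ∀ v, (K x).starProjection v = ∑ i, inner ℝ (o i x) v • o i x)
    {σ : (x : M) → V x}
    (hσ : MDifferentiableAt 𝓘(ℝ, E) (𝓘(ℝ, E).prod 𝓘(ℝ, G)) (fun x => TotalSpace.mk' G x (σ x)) x₀) :
    MDifferentiableAt 𝓘(ℝ, E) (𝓘(ℝ, E).prod 𝓘(ℝ, G))
      (fun x => TotalSpace.mk' G x ((K x).starProjection (σ x))) x₀ := by
  have ho' := fun i => (ho i).mdifferentiableAt (by simp)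
  have : ContMDiffVectorBundle 1 G V 𝓘(ℝ, E) := .of_le (n := ∞) (by simp)
  have h : MDifferentiableAt 𝓘(ℝ, E) (𝓘(ℝ, E).prod 𝓘(ℝ, G))
      (fun x => TotalSpace.mk' G x (∑ i, inner ℝ (o i x) (σ x) • o i x)) x₀ :=
    MDifferentiableAt.sum_section fun i _ => ((ho' i).inner_bundle hσ).smul_section (ho' i)
  refine h.congr_of_eventuallyEq ?_
  filter_upwards [hP] with x hx
  rw [hx]

/-- smoothness of a field of bilinear forms can be tested on smooth sections -/
theorem contMDiffAt_bilin_of_sections {G : Type*} [NormedAddCommGroup G] [NormedSpace ℝ G]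
    [FiniteDimensional ℝ G]
    {V : M → Type*} [TopologicalSpace (TotalSpace G V)] [∀ x, AddCommGroup (V x)]
    [∀ x, Module ℝ (V x)] [∀ x, TopologicalSpace (V x)] [∀ x, IsTopologicalAddGroup (V x)]
    [∀ x, ContinuousSMul ℝ (V x)] [FiberBundle G V] [VectorBundle ℝ G V]
    [ContMDiffVectorBundle ∞ G V 𝓘(ℝ, E)]
    {b : (x : M) → V x →L[ℝ] V x →L[ℝ] ℝ} {x₀ : M}
    (h : ∀ σ τ : (x : M) → V x,
      ContMDiffAt 𝓘(ℝ, E) (𝓘(ℝ, E).prod 𝓘(ℝ, G)) ∞ (fun x => TotalSpace.mk' G x (σ x)) x₀ →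
      ContMDiffAt 𝓘(ℝ, E) (𝓘(ℝ, E).prod 𝓘(ℝ, G)) ∞ (fun x => TotalSpace.mk' G x (τ x)) x₀ →
      ContMDiffAt 𝓘(ℝ, E) 𝓘(ℝ, ℝ) ∞ (fun x => b x (σ x) (τ x)) x₀) :
    ContMDiffAt 𝓘(ℝ, E) (𝓘(ℝ, E).prod 𝓘(ℝ, G →L[ℝ] G →L[ℝ] ℝ)) ∞
      (fun x => TotalSpace.mk' (G →L[ℝ] G →L[ℝ] ℝ) (E := fun x => V x →L[ℝ] V x →L[ℝ] ℝ) x (b x)) x₀ := by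
  rw [contMDiffAt_hom_bundle]
  refine ⟨contMDiffAt_id, ?_⟩
  refine contMDiffAt_clm_of_apply fun v => contMDiffAt_clm_of_apply fun w => ?_
  refine (h _ _ (FiberBundle.contMDiffAt_extend 𝓘(ℝ, E) G ((trivializationAt G V x₀).symm x₀ v))
    (FiberBundle.contMDiffAt_extend 𝓘(ℝ, E) G ((trivializationAt G V x₀).symm x₀ w))).congr_of_eventuallyEq ?_
  have hx₀ := FiberBundle.mem_baseSet_trivializationAt' (F := G) (E := V) x₀
  filter_upwards [(trivializationAt G V x₀).open_baseSet.mem_nhds hx₀] with x hx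
  rw [inCoordinates_apply_eq₂ hx hx (Set.mem_univ _)]
  simp [FiberBundle.extend, hx₀]

end Bundle

section RiemannianMetric

variable {E : Type*} [NormedAddCommGroup E] [NormedSpace ℝ E] [FiniteDimensional ℝ E]
  {M : Type*} [TopologicalSpace M] [ChartedSpace E M] [IsManifold 𝓘(ℝ, E) ∞ M]
  (g : ContMDiffRiemannianMetric 𝓘(ℝ, E) ∞ E (fun x : M => TangentSpace 𝓘(ℝ, E) x))

/-- The gradient of `h` with respect to `g`: the vector field with `g (grad h, v) = dh v`. -/
noncomputable def gradient (h : M → ℝ) (x : M) : TangentSpace 𝓘(ℝ, E) x :=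
  letI : RiemannianBundle (fun x : M => TangentSpace 𝓘(ℝ, E) x) := ⟨g.toRiemannianMetric⟩
  haveI : CompleteSpace (TangentSpace 𝓘(ℝ, E) x) := FiniteDimensional.complete ℝ _
  (InnerProductSpace.toDual ℝ (TangentSpace 𝓘(ℝ, E) x)).symm (mvfderiv 𝓘(ℝ, E) h x)

/-- The connection `cov` on the tangent bundle, with `cov Y x v` the covariant derivative
of `Y` at `x` in the direction `v`, is the Levi-Civita connection of `g`: it is torsion-free
and compatible with `g`. -/
structure IsLeviCivita (cov : CovariantDerivative 𝓘(ℝ, E) E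
    (fun x : M => TangentSpace 𝓘(ℝ, E) x)) : Prop where
  torsion_eq_zero : cov.torsion = 0
  metric : ∀ (x : M) (v : TangentSpace 𝓘(ℝ, E) x) (Y Z : (x : M) → TangentSpace 𝓘(ℝ, E) x),
    MDiffAt (T% Y) x → MDiffAt (T% Z) x →
    mvfderiv 𝓘(ℝ, E) (fun y => g.inner y (Y y) (Z y)) x v =
      g.inner x (cov Y x v) (Z x) + g.inner x (Y x) (cov Z x v)

end RiemannianMetric

section Defs

variable {E : Type*} [NormedAddCommGroup E] [NormedSpace ℝ E]
  {M : Type*} [TopologicalSpace M] [ChartedSpace E M]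

/-- A smooth foliation of dimension `p` and codimension `q` on the manifold `M`, given by a foliated
atlas: smooth charts of `M` with values in `ℝ^p × ℝ^q` whose images are products with connected
first factor, and whose transition maps have the form `(a, b) ↦ (h₁ (a, b), h₂ b)` locally. -/
structure Foliation (E : Type*) [NormedAddCommGroup E] [NormedSpace ℝ E]
    (M : Type*) [TopologicalSpace M] [ChartedSpace E M] (p q : ℕ) where
  /-- The foliated charts. -/
  charts : Set (OpenPartialHomeomorph M (EuclideanSpace ℝ (Fin p) × EuclideanSpace ℝ (Fin q)))
  exists_chart : ∀ x : M, ∃ φ ∈ charts, x ∈ φ.source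
  contMDiffOn : ∀ φ ∈ charts, ContMDiffOn 𝓘(ℝ, E)
    𝓘(ℝ, EuclideanSpace ℝ (Fin p) × EuclideanSpace ℝ (Fin q)) ∞ φ φ.source
  contMDiffOn_symm : ∀ φ ∈ charts, ContMDiffOn
    𝓘(ℝ, EuclideanSpace ℝ (Fin p) × EuclideanSpace ℝ (Fin q)) 𝓘(ℝ, E) ∞ φ.symm φ.target
  target_eq_prod : ∀ φ ∈ charts, ∃ (A : Set (EuclideanSpace ℝ (Fin p)))
    (B : Set (EuclideanSpace ℝ (Fin q))), IsPreconnected A ∧ φ.target = A ×ˢ B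
  /-- Near every common point, the transverse coordinate of one chart is a function of the
  transverse coordinate of the other. -/
  coherent : ∀ φ ∈ charts, ∀ ψ ∈ charts, ∀ x ∈ φ.source ∩ ψ.source,
    ∃ W ∈ 𝓝 x, ∀ y ∈ W, ∀ z ∈ W, (φ y).2 = (φ z).2 → (ψ y).2 = (ψ z).2

namespace Foliation

variable {p q : ℕ} (F : Foliation E M p q)

/-- Two points lie in a common plaque, that is, in a common slice of constant transverse coordinate
of some foliated chart. -/
def SamePlaque (x y : M) : Prop :=
  ∃ φ ∈ F.charts, x ∈ φ.source ∧ y ∈ φ.source ∧ (φ x).2 = (φ y).2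

/-- The leaf through `x`: all points that are joined to `x` by a finite chain of plaques. -/
def leaf (x : M) : Set M := {y | Relation.EqvGen F.SamePlaque x y}

/-- The tangent distribution of the foliation: the vectors that are annihilated by the differential
of the transverse coordinate of every (equivalently, of one) foliated chart around `x`. -/
noncomputable def tangent (x : M) : Submodule ℝ (TangentSpace 𝓘(ℝ, E) x) :=
  ⨅ φ ∈ F.charts, ⨅ _ : x ∈ φ.source, (mvfderiv 𝓘(ℝ, E) (fun y => (φ y).2) x).ker

theorem mdifferentiable [IsManifold 𝓘(ℝ, E) ∞ M] {φ} (hφ : φ ∈ F.charts) :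
    φ.MDifferentiable 𝓘(ℝ, E)
      𝓘(ℝ, EuclideanSpace ℝ (Fin p) × EuclideanSpace ℝ (Fin q)) :=
  ⟨(F.contMDiffOn φ hφ).mdifferentiableOn (by simp),
    (F.contMDiffOn_symm φ hφ).mdifferentiableOn (by simp)⟩

theorem hasMFDerivAt_snd [IsManifold 𝓘(ℝ, E) ∞ M] {φ} (hφ : φ ∈ F.charts) {x : M}
    (hx : x ∈ φ.source) :
    HasMFDerivAt 𝓘(ℝ, E) 𝓘(ℝ, EuclideanSpace ℝ (Fin q)) (fun y => (φ y).2) x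
      ((ContinuousLinearMap.snd ℝ (EuclideanSpace ℝ (Fin p)) (EuclideanSpace ℝ (Fin q))).comp
        (mvfderiv 𝓘(ℝ, E) φ x)) := by
  have h1 := (F.mdifferentiable hφ).mdifferentiableAt hx
  have h2 := (ContinuousLinearMap.snd ℝ (EuclideanSpace ℝ (Fin p))
    (EuclideanSpace ℝ (Fin q))).hasMFDerivAt (x := φ x)
  exact h2.comp x h1.hasMFDerivAt

theorem mvfderiv_snd [IsManifold 𝓘(ℝ, E) ∞ M] {φ} (hφ : φ ∈ F.charts) {x : M}
    (hx : x ∈ φ.source) (v : TangentSpace 𝓘(ℝ, E) x) :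
    mvfderiv 𝓘(ℝ, E) (fun y => (φ y).2) x v = (mvfderiv 𝓘(ℝ, E) φ x v).2 :=
  congrArg (fun L => L v) (F.hasMFDerivAt_snd hφ hx).mfderiv

theorem mem_tangent_iff [IsManifold 𝓘(ℝ, E) ∞ M] {φ} (hφ : φ ∈ F.charts) {x : M}
    (hx : x ∈ φ.source) (v : TangentSpace 𝓘(ℝ, E) x) :
    v ∈ F.tangent x ↔ (mvfderiv 𝓘(ℝ, E) φ x v).2 = 0 := by
  rw [← F.mvfderiv_snd hφ hx]
  constructor
  · intro h
    simp only [tangent, Submodule.mem_iInf] at h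
    exact h φ hφ hx
  · intro h
    simp only [tangent, Submodule.mem_iInf]
    intro ψ hψ hx'
    show mvfderiv 𝓘(ℝ, E) (fun y => (ψ y).2) x v = 0
    rw [F.mvfderiv_snd hφ hx] at h
    set w := mvfderiv 𝓘(ℝ, E) φ x v with hw
    have hM := F.mdifferentiable hφ
    -- a curve through `x` with velocity `v` along which the transverse coordinate of `φ` is constant
    let c : ℝ → EuclideanSpace ℝ (Fin p) × EuclideanSpace ℝ (Fin q) := fun t => φ x + t • w
    have hc0 : c 0 = φ x := by simp [c]
    have hc : HasMFDerivAt 𝓘(ℝ, ℝ) 𝓘(ℝ, EuclideanSpace ℝ (Fin p) × EuclideanSpace ℝ (Fin q))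
        c 0 (ContinuousLinearMap.toSpanSingleton ℝ w) := by
      apply HasFDerivAt.hasMFDerivAt
      exact ((ContinuousLinearMap.toSpanSingleton ℝ w).hasFDerivAt (x := (0 : ℝ))).const_add (φ x)
    let S : (EuclideanSpace ℝ (Fin p) × EuclideanSpace ℝ (Fin q)) →L[ℝ] E :=
      mfderiv 𝓘(ℝ, EuclideanSpace ℝ (Fin p) × EuclideanSpace ℝ (Fin q)) 𝓘(ℝ, E) φ.symm (φ x)
    have hs : ∀ z, z = φ x →
        HasMFDerivAt 𝓘(ℝ, EuclideanSpace ℝ (Fin p) × EuclideanSpace ℝ (Fin q)) 𝓘(ℝ, E)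
          φ.symm z S := by
      rintro _ rfl
      exact (hM.mdifferentiableAt_symm (φ.map_source hx)).hasMFDerivAt
    let L : E →L[ℝ] EuclideanSpace ℝ (Fin q) := mvfderiv 𝓘(ℝ, E) (fun y => (ψ y).2) x
    have hL : ∀ z, z = x → HasMFDerivAt 𝓘(ℝ, E) 𝓘(ℝ, EuclideanSpace ℝ (Fin q))
        (fun y => (ψ y).2) z L := by
      rintro _ rfl
      exact (F.hasMFDerivAt_snd hψ hx').mdifferentiableAt.hasMFDerivAt
    have hγ := (hs _ hc0).comp 0 hc
    have hγ0 : (φ.symm ∘ c) 0 = x := by simp [hc0, hx]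
    have hcomp := (hL _ hγ0).comp 0 hγ
    have hcont : ContinuousAt (φ.symm ∘ c) 0 := hγ.continuousAt
    obtain ⟨W, hW, hWc⟩ := F.coherent φ hφ ψ hψ x ⟨hx, hx'⟩
    have hev : ∀ᶠ t in 𝓝 (0 : ℝ), (ψ ((φ.symm ∘ c) t)).2 = (ψ x).2 := by
      have h1 : ∀ᶠ t in 𝓝 (0 : ℝ), (φ.symm ∘ c) t ∈ W :=
        hcont (by rw [hγ0]; exact hW)
      have h2 : ∀ᶠ t in 𝓝 (0 : ℝ), c t ∈ φ.target :=
        hc.continuousAt (by rw [hc0]; exact φ.open_target.mem_nhds (φ.map_source hx))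
      filter_upwards [h1, h2] with t ht1 ht2
      refine hWc _ ht1 _ (mem_of_mem_nhds hW) ?_
      simp only [Function.comp_apply, φ.right_inv ht2]
      simp [c, h]
    have hconst : HasMFDerivAt 𝓘(ℝ, ℝ) 𝓘(ℝ, EuclideanSpace ℝ (Fin q))
        ((fun y => (ψ y).2) ∘ (φ.symm ∘ c)) 0 (0 : ℝ →L[ℝ] EuclideanSpace ℝ (Fin q)) :=
      (hasMFDerivAt_const (ψ x).2 (0 : ℝ)).congr_of_eventuallyEq hev
    have huniq := hasMFDerivAt_unique hcomp hconst
    have h1 := congrArg (fun L => L (1 : ℝ)) huniq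
    have hv : S w = v := congrArg (fun L => L v) (hM.symm_comp_deriv hx)
    have h2 : L (S ((1 : ℝ) • w)) = 0 := h1
    rw [one_smul, hv] at h2
    exact h2

/-- Near every point the tangent distribution has a smooth frame. -/
theorem exists_frame [IsManifold 𝓘(ℝ, E) ∞ M] [CompleteSpace E] (x₀ : M) :
    ∃ s : Fin p → (x : M) → TangentSpace 𝓘(ℝ, E) x,
      (∀ i, ContMDiffAt 𝓘(ℝ, E) (𝓘(ℝ, E).prod 𝓘(ℝ, E)) ∞
        (fun x => TotalSpace.mk' E x (s i x)) x₀) ∧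
      ∀ᶠ x in 𝓝 x₀, LinearIndependent ℝ (fun i => s i x) ∧
        Submodule.span ℝ (Set.range fun i => s i x) = F.tangent x := by
  obtain ⟨φ, hφ, hx₀⟩ := F.exists_chart x₀
  have hM := F.mdifferentiable hφ
  let e : Fin p → EuclideanSpace ℝ (Fin p) × EuclideanSpace ℝ (Fin q) :=
    fun i => (EuclideanSpace.single i 1, 0)
  refine ⟨fun i => VectorField.mpullback 𝓘(ℝ, E)
    𝓘(ℝ, EuclideanSpace ℝ (Fin p) × EuclideanSpace ℝ (Fin q)) φ (fun _ => e i), fun i => ?_, ?_⟩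
  · refine ContMDiffAt.mpullback_vectorField_preimage (n := ∞) ?_
      ((F.contMDiffOn φ hφ).contMDiffAt (φ.open_source.mem_nhds hx₀)) ?_ (by simp)
    · exact contMDiffAt_vectorSpace_iff_contDiffAt.2 contDiffAt_const
    · exact ⟨hM.mfderiv hx₀, rfl⟩
  · filter_upwards [φ.open_source.mem_nhds hx₀] with x hx
    let D : E ≃L[ℝ] EuclideanSpace ℝ (Fin p) × EuclideanSpace ℝ (Fin q) := hM.mfderiv hx
    let J : EuclideanSpace ℝ (Fin p) →ₗ[ℝ] E :=
      D.symm.toLinearMap ∘ₗ LinearMap.inl ℝ (EuclideanSpace ℝ (Fin p)) (EuclideanSpace ℝ (Fin q))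
    have hs : (fun i => VectorField.mpullback 𝓘(ℝ, E)
        𝓘(ℝ, EuclideanSpace ℝ (Fin p) × EuclideanSpace ℝ (Fin q)) φ (fun _ => e i) x) =
        J ∘ (EuclideanSpace.basisFun (Fin p) ℝ).toBasis := by
      funext i
      have h1 : VectorField.mpullback 𝓘(ℝ, E)
          𝓘(ℝ, EuclideanSpace ℝ (Fin p) × EuclideanSpace ℝ (Fin q)) φ (fun _ => e i) x =
          D.symm (e i) :=
        congrArg (fun L => L (e i)) (ContinuousLinearMap.inverse_equiv (hM.mfderiv hx))
      refine h1.trans ?_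
      simp [J, e]
      rfl
    rw [hs]
    constructor
    · refine (EuclideanSpace.basisFun (Fin p) ℝ).toBasis.linearIndependent.map' J ?_
      rw [LinearMap.ker_eq_bot]
      exact D.symm.injective.comp LinearMap.inl_injective
    · have : Submodule.span ℝ (Set.range (J ∘ (EuclideanSpace.basisFun (Fin p) ℝ).toBasis)) =
          LinearMap.range J := by
        rw [Set.range_comp, Submodule.span_image, Module.Basis.span_eq, Submodule.map_top]
      refine this.trans ?_
      ext v
      refine Iff.trans ?_ (F.mem_tangent_iff hφ hx v).symm
      change _ ↔ (D v).2 = 0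
      constructor
      · rintro ⟨a, rfl⟩
        simp [J]
      · intro h
        refine ⟨(D v).1, ?_⟩
        have : ((D v).1, (0 : EuclideanSpace ℝ (Fin q))) = D v := by rw [← h]
        simp [J, this]

section Proj
variable [FiniteDimensional ℝ E] [IsManifold 𝓘(ℝ, E) ∞ M]
  [RiemannianBundle (fun x : M => TangentSpace 𝓘(ℝ, E) x)]
  [IsContMDiffRiemannianBundle 𝓘(ℝ, E) ∞ E (fun x : M => TangentSpace 𝓘(ℝ, E) x)]

theorem contMDiffAt_starProjection {σ : (x : M) → TangentSpace 𝓘(ℝ, E) x} {x₀ : M}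
    (hσ : ContMDiffAt 𝓘(ℝ, E) (𝓘(ℝ, E).prod 𝓘(ℝ, E)) ∞ (fun x => TotalSpace.mk' E x (σ x)) x₀) :
    ContMDiffAt 𝓘(ℝ, E) (𝓘(ℝ, E).prod 𝓘(ℝ, E)) ∞
      (fun x => TotalSpace.mk' E x ((F.tangent x).starProjection (σ x))) x₀ := by
  obtain ⟨s, hs, hspan⟩ := F.exists_frame x₀
  obtain ⟨o, ho, hP⟩ := exists_orthonormal_frame (E := E) (G := E) (V := fun x : M => TangentSpace 𝓘(ℝ, E) x)
    (K := F.tangent) (s := s) (x₀ := x₀) hs hspan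
  exact contMDiffAt_starProjection_of_frame (E := E) (G := E) (V := fun x : M => TangentSpace 𝓘(ℝ, E) x)
    (K := F.tangent) (o := o) (x₀ := x₀) ho hP (σ := σ) hσ

theorem mdifferentiableAt_starProjection {σ : (x : M) → TangentSpace 𝓘(ℝ, E) x} {x₀ : M}
    (hσ : MDifferentiableAt 𝓘(ℝ, E) (𝓘(ℝ, E).prod 𝓘(ℝ, E)) (fun x => TotalSpace.mk' E x (σ x)) x₀) :
    MDifferentiableAt 𝓘(ℝ, E) (𝓘(ℝ, E).prod 𝓘(ℝ, E))
      (fun x => TotalSpace.mk' E x ((F.tangent x).starProjection (σ x))) x₀ := by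
  obtain ⟨s, hs, hspan⟩ := F.exists_frame x₀
  obtain ⟨o, ho, hP⟩ := exists_orthonormal_frame (E := E) (G := E) (V := fun x : M => TangentSpace 𝓘(ℝ, E) x)
    (K := F.tangent) (s := s) (x₀ := x₀) hs hspan
  exact mdifferentiableAt_starProjection_of_frame (E := E) (G := E) (V := fun x : M => TangentSpace 𝓘(ℝ, E) x)
    (K := F.tangent) (o := o) (x₀ := x₀) ho hP (σ := σ) hσ

end Proj

section Metric
variable [FiniteDimensional ℝ E] [IsManifold 𝓘(ℝ, E) ∞ M]
  (g : ContMDiffRiemannianMetric 𝓘(ℝ, E) ∞ E (fun x : M => TangentSpace 𝓘(ℝ, E) x))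

/-- The orthogonal distribution of the foliation with respect to `g`. -/
def normal (x : M) : Submodule ℝ (TangentSpace 𝓘(ℝ, E) x) where
  carrier := {v | ∀ u ∈ F.tangent x, g.inner x u v = 0}
  add_mem' ha hb u hu := by rw [map_add, ha u hu, hb u hu, add_zero]
  zero_mem' u _ := map_zero _
  smul_mem' c a ha u hu := by rw [map_smul, ha u hu, smul_zero]

/-- The `g`-orthogonal projection onto the tangent distribution. -/
noncomputable def projTangent (x : M) : TangentSpace 𝓘(ℝ, E) x →L[ℝ] TangentSpace 𝓘(ℝ, E) x :=
  letI : RiemannianBundle (fun x : M => TangentSpace 𝓘(ℝ, E) x) := ⟨g.toRiemannianMetric⟩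
  (F.tangent x).starProjection

/-- The `g`-orthogonal projection onto the orthogonal distribution. -/
noncomputable def projNormal (x : M) : TangentSpace 𝓘(ℝ, E) x →L[ℝ] TangentSpace 𝓘(ℝ, E) x :=
  ContinuousLinearMap.id ℝ (TangentSpace 𝓘(ℝ, E) x) - F.projTangent g x

theorem projTangent_mem (x : M) (v : TangentSpace 𝓘(ℝ, E) x) :
    F.projTangent g x v ∈ F.tangent x := by
  let _ : RiemannianBundle (fun x : M => TangentSpace 𝓘(ℝ, E) x) := ⟨g.toRiemannianMetric⟩
  exact Submodule.starProjection_apply_mem _ _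

theorem projNormal_mem (x : M) (v : TangentSpace 𝓘(ℝ, E) x) :
    F.projNormal g x v ∈ F.normal g x := by
  let _ : RiemannianBundle (fun x : M => TangentSpace 𝓘(ℝ, E) x) := ⟨g.toRiemannianMetric⟩
  exact fun u hu => (Submodule.sub_starProjection_mem_orthogonal (K := F.tangent x) v) u hu

theorem projTangent_add_projNormal (x : M) (v : TangentSpace 𝓘(ℝ, E) x) :
    F.projTangent g x v + F.projNormal g x v = v :=
  add_sub_cancel _ _

theorem projTangent_of_mem_normal {x : M} {v : TangentSpace 𝓘(ℝ, E) x} (hv : v ∈ F.normal g x) :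
    F.projTangent g x v = 0 := by
  let _ : RiemannianBundle (fun x : M => TangentSpace 𝓘(ℝ, E) x) := ⟨g.toRiemannianMetric⟩
  exact (Submodule.starProjection_apply_eq_zero_iff (K := F.tangent x)).2
    (fun u hu => hv u hu)

theorem contMDiffAt_projTangent {σ : (x : M) → TangentSpace 𝓘(ℝ, E) x} {x₀ : M}
    (hσ : ContMDiffAt 𝓘(ℝ, E) (𝓘(ℝ, E).prod 𝓘(ℝ, E)) ∞ (fun x => TotalSpace.mk' E x (σ x)) x₀) :
    ContMDiffAt 𝓘(ℝ, E) (𝓘(ℝ, E).prod 𝓘(ℝ, E)) ∞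
      (fun x => TotalSpace.mk' E x (F.projTangent g x (σ x))) x₀ := by
  let _ : RiemannianBundle (fun x : M => TangentSpace 𝓘(ℝ, E) x) := ⟨g.toRiemannianMetric⟩
  exact F.contMDiffAt_starProjection hσ

theorem contMDiffAt_projNormal {σ : (x : M) → TangentSpace 𝓘(ℝ, E) x} {x₀ : M}
    (hσ : ContMDiffAt 𝓘(ℝ, E) (𝓘(ℝ, E).prod 𝓘(ℝ, E)) ∞ (fun x => TotalSpace.mk' E x (σ x)) x₀) :
    ContMDiffAt 𝓘(ℝ, E) (𝓘(ℝ, E).prod 𝓘(ℝ, E)) ∞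
      (fun x => TotalSpace.mk' E x (F.projNormal g x (σ x))) x₀ :=
  hσ.sub_section (F.contMDiffAt_projTangent g hσ)

theorem mdifferentiableAt_projTangent {σ : (x : M) → TangentSpace 𝓘(ℝ, E) x} {x₀ : M}
    (hσ : MDifferentiableAt 𝓘(ℝ, E) (𝓘(ℝ, E).prod 𝓘(ℝ, E)) (fun x => TotalSpace.mk' E x (σ x)) x₀) :
    MDifferentiableAt 𝓘(ℝ, E) (𝓘(ℝ, E).prod 𝓘(ℝ, E))
      (fun x => TotalSpace.mk' E x (F.projTangent g x (σ x))) x₀ := by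
  let _ : RiemannianBundle (fun x : M => TangentSpace 𝓘(ℝ, E) x) := ⟨g.toRiemannianMetric⟩
  exact F.mdifferentiableAt_starProjection hσ

theorem mdifferentiableAt_projNormal {σ : (x : M) → TangentSpace 𝓘(ℝ, E) x} {x₀ : M}
    (hσ : MDifferentiableAt 𝓘(ℝ, E) (𝓘(ℝ, E).prod 𝓘(ℝ, E)) (fun x => TotalSpace.mk' E x (σ x)) x₀) :
    MDifferentiableAt 𝓘(ℝ, E) (𝓘(ℝ, E).prod 𝓘(ℝ, E))
      (fun x => TotalSpace.mk' E x (F.projNormal g x (σ x))) x₀ :=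
  mdifferentiableAt_sub_section hσ (F.mdifferentiableAt_projTangent g hσ)

/-- A warping function: smooth, positive and constant along the leaves. -/
structure IsWarpingFunction (f : M → ℝ) : Prop where
  contMDiff : ContMDiff 𝓘(ℝ, E) 𝓘(ℝ, ℝ) ∞ f
  pos : ∀ x, 0 < f x
  eq_of_mem_leaf : ∀ x, ∀ y ∈ F.leaf x, f y = f x

/-- The bilinear form that is `f² g` on tangent vectors and equals `g` as soon as one of the two
arguments is orthogonal to the foliation. -/
noncomputable def warpedInner (f : M → ℝ) (x : M) :
    TangentSpace 𝓘(ℝ, E) x →L[ℝ] TangentSpace 𝓘(ℝ, E) x →L[ℝ] ℝ :=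
  letI : RiemannianBundle (fun x : M => TangentSpace 𝓘(ℝ, E) x) := ⟨g.toRiemannianMetric⟩
  f x ^ 2 • (g.inner x).bilinearComp (F.projTangent g x) (F.projTangent g x) +
    (g.inner x).bilinearComp (F.projNormal g x) (F.projNormal g x)

theorem warpedInner_apply (f : M → ℝ) (x : M) (v w : TangentSpace 𝓘(ℝ, E) x) :
    F.warpedInner g f x v w = f x ^ 2 * g.inner x (F.projTangent g x v) (F.projTangent g x w) +
      g.inner x (F.projNormal g x v) (F.projNormal g x w) := rfl

theorem contMDiff_inner_apply {σ τ : (x : M) → TangentSpace 𝓘(ℝ, E) x} {x₀ : M}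
    (hσ : ContMDiffAt 𝓘(ℝ, E) (𝓘(ℝ, E).prod 𝓘(ℝ, E)) ∞ (fun x => TotalSpace.mk' E x (σ x)) x₀)
    (hτ : ContMDiffAt 𝓘(ℝ, E) (𝓘(ℝ, E).prod 𝓘(ℝ, E)) ∞ (fun x => TotalSpace.mk' E x (τ x)) x₀) :
    ContMDiffAt 𝓘(ℝ, E) 𝓘(ℝ, ℝ) ∞ (fun x => g.inner x (σ x) (τ x)) x₀ := by
  let _ : RiemannianBundle (fun x : M => TangentSpace 𝓘(ℝ, E) x) := ⟨g.toRiemannianMetric⟩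
  exact ContMDiffAt.inner_bundle (F := E) (E := fun x : M => TangentSpace 𝓘(ℝ, E) x)
    (b := fun x => x) (v := σ) (w := τ) hσ hτ

/-- The metric `g_f` of the warped foliation. -/
noncomputable def warpedMetric (f : M → ℝ) (hf : F.IsWarpingFunction f) :
    ContMDiffRiemannianMetric 𝓘(ℝ, E) ∞ E (fun x : M => TangentSpace 𝓘(ℝ, E) x) where
  inner := F.warpedInner g f
  symm x v w := by
    simp only [warpedInner_apply, g.symm x (F.projTangent g x v), g.symm x (F.projNormal g x v)]
  pos x v hv := by
    rw [warpedInner_apply]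
    have hnn : ∀ w, 0 ≤ g.inner x w w := fun w => by
      rcases eq_or_ne w 0 with rfl | hw
      · simp
      · exact (g.pos x w hw).le
    have h1 := mul_nonneg (sq_nonneg (f x)) (hnn (F.projTangent g x v))
    by_cases hN : F.projNormal g x v = 0
    · have hT : F.projTangent g x v ≠ 0 := fun h => hv (by
        rw [← F.projTangent_add_projNormal g x v, h, hN, add_zero])
      exact add_pos_of_pos_of_nonneg (mul_pos (pow_pos (hf.pos x) 2) (g.pos x _ hT)) (hnn _)
    · exact add_pos_of_nonneg_of_pos h1 (g.pos x _ hN)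
  isVonNBounded x := by
    let _ : RiemannianBundle (fun x : M => TangentSpace 𝓘(ℝ, E) x) := ⟨g.toRiemannianMetric⟩
    have hc : 0 < min (f x ^ 2) 1 := lt_min (pow_pos (hf.pos x) 2) one_pos
    refine (NormedSpace.isVonNBounded_ball ℝ (TangentSpace 𝓘(ℝ, E) x)
      (Real.sqrt (min (f x ^ 2) 1)⁻¹)).subset fun v hv => ?_
    have hv' : f x ^ 2 * g.inner x (F.projTangent g x v) (F.projTangent g x v) +
      g.inner x (F.projNormal g x v) (F.projNormal g x v) < 1 := hv
    have hn : g.inner x v v = ‖v‖ ^ 2 := real_inner_self_eq_norm_sq (F := TangentSpace 𝓘(ℝ, E) x) v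
    have hT : 0 ≤ g.inner x (F.projTangent g x v) (F.projTangent g x v) :=
      real_inner_self_nonneg (F := TangentSpace 𝓘(ℝ, E) x)
    have hN : 0 ≤ g.inner x (F.projNormal g x v) (F.projNormal g x v) :=
      real_inner_self_nonneg (F := TangentSpace 𝓘(ℝ, E) x)
    have hs : g.inner x v v = g.inner x (F.projTangent g x v) (F.projTangent g x v) +
        g.inner x (F.projNormal g x v) (F.projNormal g x v) := by
      have h0 := F.projNormal_mem g x v _ (F.projTangent_mem g x v)
      have h0' := h0
      rw [g.symm] at h0'
      conv_lhs => rw [← F.projTangent_add_projNormal g x v]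
      simp only [map_add, add_apply, h0, h0']
      ring
    have h1 : min (f x ^ 2) 1 * ‖v‖ ^ 2 < 1 := by
      rw [← hn, hs]
      nlinarith [mul_le_mul_of_nonneg_right (min_le_left (f x ^ 2) 1) hT,
        mul_le_mul_of_nonneg_right (min_le_right (f x ^ 2) 1) hN]
    rw [mem_ball_zero_iff]
    refine Real.lt_sqrt_of_sq_lt ?_
    rw [← one_div, lt_div_iff₀ hc, mul_comm]
    exact h1
  contMDiff x₀ := by
    refine contMDiffAt_bilin_of_sections (E := E) (G := E)
      (V := fun x : M => TangentSpace 𝓘(ℝ, E) x) fun σ τ hσ hτ => ?_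
    simp only [warpedInner_apply]
    exact ((hf.contMDiff.contMDiffAt.pow 2).mul (contMDiff_inner_apply g
      (F.contMDiffAt_projTangent g hσ) (F.contMDiffAt_projTangent g hτ))).add
      (contMDiff_inner_apply g (F.contMDiffAt_projNormal g hσ) (F.contMDiffAt_projNormal g hτ))


variable (cov : CovariantDerivative 𝓘(ℝ, E) E (fun x : M => TangentSpace 𝓘(ℝ, E) x))

/-- The tangent part of `1/2 ∇_X Y - 1/2 ∇_Y X`, where `X` and `Y` are first projected to the
orthogonal distribution. -/
noncomputable def integrabilityAux (X Y : (x : M) → TangentSpace 𝓘(ℝ, E) x) (x : M) :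
    TangentSpace 𝓘(ℝ, E) x :=
  F.projTangent g x ((1 / 2 : ℝ) • cov (fun y => F.projNormal g y (Y y)) x (F.projNormal g x (X x)) -
    (1 / 2 : ℝ) • cov (fun y => F.projNormal g y (X y)) x (F.projNormal g x (Y x)))

theorem integrabilityAux_swap (X Y : (x : M) → TangentSpace 𝓘(ℝ, E) x) (x : M) :
    F.integrabilityAux g cov X Y x = - F.integrabilityAux g cov Y X x := by
  simp only [integrabilityAux]
  rw [← map_neg, neg_sub]

theorem tensorial_left (x : M) (Y : (x : M) → TangentSpace 𝓘(ℝ, E) x)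
    (hY : MDifferentiableAt 𝓘(ℝ, E) (𝓘(ℝ, E).prod 𝓘(ℝ, E)) (fun x => TotalSpace.mk' E x (Y x)) x) :
    TensorialAt 𝓘(ℝ, E) E (fun X => F.integrabilityAux g cov X Y x) x where
  smul {h X} hh hX := by
    have e : (fun y => F.projNormal g y ((h • X) y)) = h • (fun y => F.projNormal g y (X y)) := by
      funext y; exact map_smul _ _ _
    have hl := cov.isCovariantDerivativeOn.leibniz (F.mdifferentiableAt_projNormal g hX) hh
    have ex : F.projNormal g x ((h • X) x) = h x • F.projNormal g x (X x) := map_smul _ _ _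
    have hz := F.projTangent_of_mem_normal g (F.projNormal_mem g x (X x))
    simp only [integrabilityAux]
    rw [e, ex, hl]
    simp only [map_sub, map_smul, add_apply, _root_.smul_apply,
      ContinuousLinearMap.smulRight_apply, map_add, hz]
    module
  add {X X'} hX hX' := by
    have e : (fun y => F.projNormal g y ((X + X') y)) =
        (fun y => F.projNormal g y (X y)) + (fun y => F.projNormal g y (X' y)) := by
      funext y; exact map_add _ _ _
    have hl := cov.isCovariantDerivativeOn.add (F.mdifferentiableAt_projNormal g hX)
      (F.mdifferentiableAt_projNormal g hX')
    have ex : F.projNormal g x ((X + X') x) = F.projNormal g x (X x) + F.projNormal g x (X' x) :=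
      map_add _ _ _
    simp only [integrabilityAux]
    rw [e, ex, hl]
    simp only [map_sub, map_smul, add_apply, map_add]
    module

theorem tensorial_right (x : M) (X : (x : M) → TangentSpace 𝓘(ℝ, E) x)
    (hX : MDifferentiableAt 𝓘(ℝ, E) (𝓘(ℝ, E).prod 𝓘(ℝ, E)) (fun x => TotalSpace.mk' E x (X x)) x) :
    TensorialAt 𝓘(ℝ, E) E (fun Y => F.integrabilityAux g cov X Y x) x where
  smul {h Y} hh hY := by
    simp only [F.integrabilityAux_swap g cov X, (F.tensorial_left g cov x X hX).smul hh hY, smul_neg]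
  add {Y Y'} hY hY' := by
    simp only [F.integrabilityAux_swap g cov X, (F.tensorial_left g cov x X hX).add hY hY', neg_add]

/-- The bilinear map on vectors that is induced by `integrabilityAux`, which is tensorial in both
fields. -/
noncomputable def integrabilityForm (x : M) :
    TangentSpace 𝓘(ℝ, E) x →L[ℝ] TangentSpace 𝓘(ℝ, E) x →L[ℝ] TangentSpace 𝓘(ℝ, E) x :=
  TensorialAt.mkHom₂ (fun X Y => F.integrabilityAux g cov X Y x) x
    (F.tensorial_left g cov x) (F.tensorial_right g cov x)

/-- The integrability tensor `A` of the orthogonal distribution, for vectors `u`, `v` at `x`. For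
orthogonal `X`, `Y` and tangent `U`, `V` it is given by: `A (X, Y)` is the tangent part of
`1/2 ∇_X Y - 1/2 ∇_Y X`; `A (X, U)` is the orthogonal vector with
`g (A (X, U), Y) = - g (A (X, Y), U)`; and `A (U, ·) = 0`. Since the bilinear form `B` of the first
clause vanishes when an argument is tangent and has tangent values, `A (u, ·)` is `B (u, ·)`
minus its `g`-adjoint. -/
noncomputable def integrabilityTensor (x : M) (u v : TangentSpace 𝓘(ℝ, E) x) :
    TangentSpace 𝓘(ℝ, E) x :=
  letI : RiemannianBundle (fun x : M => TangentSpace 𝓘(ℝ, E) x) := ⟨g.toRiemannianMetric⟩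
  haveI : CompleteSpace (TangentSpace 𝓘(ℝ, E) x) := FiniteDimensional.complete ℝ _
  F.integrabilityForm g cov x u v - ContinuousLinearMap.adjoint (F.integrabilityForm g cov x u) v

end Metric
end Foliation
end Defs
end WarpedFoliation

namespace WarpedFoliation

/-! ### Vector fields on a vector space -/

section VectorSpace

variable {E : Type*} [NormedAddCommGroup E] [NormedSpace ℝ E]

/-! The Koszul formula expresses 2⟨∇_A B, C⟩ through derivatives of inner products and through inner
products with Lie brackets. The derivative operators and the brackets do not depend on the metric,
so the formulas for g and g_f can be compared term by term. As soon as one argument w is tangent,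
g_f(v, w) = f² g(v, w) for every v; as soon as one is normal, g_f(v, w) = g(v, w)
(`warpedInner_tangent`, `warpedInner_normal`). Hence each term for g_f is the term for g times f² or
1, plus derivatives of f² from the product rule. A vector is determined by its inner products with
tangent and with normal vectors (`eq_of_inner_eq`), so it suffices to let C be tangent or normal.

Three facts evaluate what remains. The differential of f² vanishes on tangent vectors, because f is
constant along leaves (`mvfderiv_eq_zero_of_mem_tangent`). Brackets of tangent fields are tangent
(`mlieBracket_mem_tangent`), so they drop out against normal fields. Finally, ∇ is torsion-free, so
A(X, Y) = ½ [X, Y]^⊤ for normal X, Y (`integrabilityForm_normal`): the multiples of A account for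
the bracket of two normal fields against a tangent one, which picks up f² while the terms around it
do not.

The formula for ∇^f_U X follows from that for ∇^f_X U, since both connections are torsion-free and
have the same difference [X, U]. -/

theorem two_le_infty : (2 : ℕ∞ω) ≤ ∞ :=
  WithTop.coe_le_coe.2 (le_top : (2 : ℕ∞) ≤ ⊤)

theorem mlieBracket_eq_lieBracket (V W : (x : E) → TangentSpace 𝓘(ℝ, E) x) :
    VectorField.mlieBracket 𝓘(ℝ, E) V W = VectorField.lieBracket ℝ V W := by
  rw [← VectorField.mlieBracketWithin_univ, VectorField.mlieBracketWithin_eq_lieBracketWithin]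
  exact VectorField.lieBracketWithin_univ

/-- The fibre coordinate on the tangent bundle of a vector space is smooth, and composing it with
the section gives the field as a map E → E. -/
theorem differentiableAt_of_mdifferentiableAt_vectorSpace {V : (x : E) → TangentSpace 𝓘(ℝ, E) x}
    {x : E} (h : MDiffAt (T% V) x) : DifferentiableAt ℝ (V : E → E) x :=
  MDifferentiableAt.differentiableAt <|
    ((contMDiff_snd_tangentBundle_modelSpace E 𝓘(ℝ, E)).contMDiffAt.mdifferentiableAt
      one_ne_zero).comp x h

end VectorSpace

/-! ### Gradient, torsion and the Koszul formula -/

section LeviCivita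

variable {E : Type*} [NormedAddCommGroup E] [NormedSpace ℝ E] [FiniteDimensional ℝ E]
  {M : Type*} [TopologicalSpace M] [ChartedSpace E M] [IsManifold 𝓘(ℝ, E) ∞ M]
  {g : ContMDiffRiemannianMetric 𝓘(ℝ, E) ∞ E (fun x : M => TangentSpace 𝓘(ℝ, E) x)}
  {cov : CovariantDerivative 𝓘(ℝ, E) E (fun x : M => TangentSpace 𝓘(ℝ, E) x)}

theorem inner_gradient (g : ContMDiffRiemannianMetric 𝓘(ℝ, E) ∞ E
    (fun x : M => TangentSpace 𝓘(ℝ, E) x)) (h : M → ℝ) (x : M) (v : TangentSpace 𝓘(ℝ, E) x) :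
    g.inner x (gradient g h x) v = mvfderiv 𝓘(ℝ, E) h x v := by
  let _ : RiemannianBundle (fun x : M => TangentSpace 𝓘(ℝ, E) x) := ⟨g.toRiemannianMetric⟩
  have : CompleteSpace (TangentSpace 𝓘(ℝ, E) x) := FiniteDimensional.complete ℝ _
  exact InnerProductSpace.toDual_symm_apply (𝕜 := ℝ) (E := TangentSpace 𝓘(ℝ, E) x)

theorem IsLeviCivita.sub_swap (h : IsLeviCivita g cov) {x : M}
    {X Y : (x : M) → TangentSpace 𝓘(ℝ, E) x} (hX : MDiffAt (T% X) x) (hY : MDiffAt (T% Y) x) :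
    cov Y x (X x) - cov X x (Y x) = VectorField.mlieBracket 𝓘(ℝ, E) X Y x :=
  cov.torsion_eq_zero_iff.1 h.torsion_eq_zero hX hY

/-- The Koszul formula. -/
theorem IsLeviCivita.koszul (h : IsLeviCivita g cov) {x : M}
    {X Y Z : (x : M) → TangentSpace 𝓘(ℝ, E) x} (hX : MDiffAt (T% X) x) (hY : MDiffAt (T% Y) x)
    (hZ : MDiffAt (T% Z) x) :
    2 * g.inner x (cov Y x (X x)) (Z x) =
      mvfderiv 𝓘(ℝ, E) (fun y => g.inner y (Y y) (Z y)) x (X x) +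
      mvfderiv 𝓘(ℝ, E) (fun y => g.inner y (Z y) (X y)) x (Y x) -
      mvfderiv 𝓘(ℝ, E) (fun y => g.inner y (X y) (Y y)) x (Z x) +
      g.inner x (VectorField.mlieBracket 𝓘(ℝ, E) X Y x) (Z x) -
      g.inner x (VectorField.mlieBracket 𝓘(ℝ, E) Y Z x) (X x) +
      g.inner x (VectorField.mlieBracket 𝓘(ℝ, E) Z X x) (Y x) := by
  rw [h.metric x _ Y Z hY hZ, h.metric x _ Z X hZ hX, h.metric x _ X Y hX hY,
    ← h.sub_swap hX hY, ← h.sub_swap hY hZ, ← h.sub_swap hZ hX]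
  simp only [map_sub, sub_apply]
  rw [g.symm x (Y x), g.symm x (Z x), g.symm x (X x)]
  ring

end LeviCivita

namespace Foliation

/-! ### Leafwise constant functions and involutivity -/

section Tangent

variable {E : Type*} [NormedAddCommGroup E] [NormedSpace ℝ E]
  {M : Type*} [TopologicalSpace M] [ChartedSpace E M] [IsManifold 𝓘(ℝ, E) ∞ M]
  {p q : ℕ} (F : Foliation E M p q)

/-- A function that is constant along the leaves has no derivative in tangent directions. -/
theorem mvfderiv_eq_zero_of_mem_tangent {h : M → ℝ} {x : M} (hd : MDiffAt h x)
    (hh : ∀ x, ∀ y ∈ F.leaf x, h y = h x) {v : TangentSpace 𝓘(ℝ, E) x} (hv : v ∈ F.tangent x) :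
    mvfderiv 𝓘(ℝ, E) h x v = 0 := by
  obtain ⟨φ, hφ, hx⟩ := F.exists_chart x
  have hM := F.mdifferentiable hφ
  rw [F.mem_tangent_iff hφ hx] at hv
  set w := mvfderiv 𝓘(ℝ, E) φ x v with hw
  -- The image under `φ.symm` of the line through `φ x` with direction `w` = dφ(v) has velocity `v`
  -- at `x`. As `w` has no transverse component, the curve stays in one plaque for small t, so `h`
  -- is constant along it.
  let c : ℝ → EuclideanSpace ℝ (Fin p) × EuclideanSpace ℝ (Fin q) := fun t => φ x + t • w
  have hc0 : c 0 = φ x := by simp [c]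
  have hc : HasMFDerivAt 𝓘(ℝ, ℝ) 𝓘(ℝ, EuclideanSpace ℝ (Fin p) × EuclideanSpace ℝ (Fin q))
      c 0 (ContinuousLinearMap.toSpanSingleton ℝ w) := by
    apply HasFDerivAt.hasMFDerivAt
    exact ((ContinuousLinearMap.toSpanSingleton ℝ w).hasFDerivAt (x := (0 : ℝ))).const_add (φ x)
  let S : (EuclideanSpace ℝ (Fin p) × EuclideanSpace ℝ (Fin q)) →L[ℝ] E :=
    mfderiv 𝓘(ℝ, EuclideanSpace ℝ (Fin p) × EuclideanSpace ℝ (Fin q)) 𝓘(ℝ, E) φ.symm (φ x)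
  -- The base point is a variable because `c 0` and `φ x` are only propositionally equal; `S` and
  -- `L` are maps between the model spaces, so their types do not mention it.
  have hs : ∀ z, z = φ x →
      HasMFDerivAt 𝓘(ℝ, EuclideanSpace ℝ (Fin p) × EuclideanSpace ℝ (Fin q)) 𝓘(ℝ, E)
        φ.symm z S := by
    rintro _ rfl
    exact (hM.mdifferentiableAt_symm (φ.map_source hx)).hasMFDerivAt
  let L : E →L[ℝ] ℝ := mvfderiv 𝓘(ℝ, E) h x
  have hL : ∀ z, z = x → HasMFDerivAt 𝓘(ℝ, E) 𝓘(ℝ, ℝ) h z L := by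
    rintro _ rfl
    exact hd.hasMFDerivAt
  have hγ := (hs _ hc0).comp 0 hc
  have hγ0 : (φ.symm ∘ c) 0 = x := by simp [hc0, hx]
  have hcomp := (hL _ hγ0).comp 0 hγ
  have hev : ∀ᶠ t in 𝓝 (0 : ℝ), h ((φ.symm ∘ c) t) = h x := by
    have h2 : ∀ᶠ t in 𝓝 (0 : ℝ), c t ∈ φ.target :=
      hc.continuousAt (by rw [hc0]; exact φ.open_target.mem_nhds (φ.map_source hx))
    filter_upwards [h2] with t ht
    refine hh x _ (Relation.EqvGen.rel _ _ ⟨φ, hφ, hx, φ.map_target ht, ?_⟩)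
    simp only [Function.comp_apply, φ.right_inv ht]
    simp [c, hv]
  have hconst : HasMFDerivAt 𝓘(ℝ, ℝ) 𝓘(ℝ, ℝ) (h ∘ (φ.symm ∘ c)) 0 (0 : ℝ →L[ℝ] ℝ) :=
    (hasMFDerivAt_const (h x) (0 : ℝ)).congr_of_eventuallyEq hev
  have h1 := congrArg (fun L => L (1 : ℝ)) (hasMFDerivAt_unique hcomp hconst)
  have hv : S w = v := congrArg (fun L => L v) (hM.symm_comp_deriv hx)
  have h2 : L (S ((1 : ℝ) • w)) = 0 := h1
  rw [one_smul, hv] at h2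
  exact h2

/-- The tangent distribution is involutive. -/
theorem mlieBracket_mem_tangent [CompleteSpace E] {U V : (x : M) → TangentSpace 𝓘(ℝ, E) x} {x : M}
    (hU : MDiffAt (T% U) x) (hV : MDiffAt (T% V) x) (hUt : ∀ᶠ y in 𝓝 x, U y ∈ F.tangent y)
    (hVt : ∀ᶠ y in 𝓝 x, V y ∈ F.tangent y) :
    VectorField.mlieBracket 𝓘(ℝ, E) U V x ∈ F.tangent x := by
  obtain ⟨φ, hφ, hx⟩ := F.exists_chart x
  have hM := F.mdifferentiable hφ
  have : IsManifold 𝓘(ℝ, E) (minSmoothness ℝ 2) M := .of_le (n := ∞) (by simpa using two_le_infty)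
  let G := EuclideanSpace ℝ (Fin p) × EuclideanSpace ℝ (Fin q)
  have hz : φ x ∈ φ.target := φ.map_source hx
  have hinv : ∀ z ∈ φ.target, (mfderiv 𝓘(ℝ, G) 𝓘(ℝ, E) φ.symm z).IsInvertible := fun z hz =>
    ⟨hM.symm.mfderiv hz, rfl⟩
  have hpull : ∀ (W : (x : M) → TangentSpace 𝓘(ℝ, E) x), ∀ z ∈ φ.target,
      VectorField.mpullback 𝓘(ℝ, G) 𝓘(ℝ, E) φ.symm W z =
        mvfderiv 𝓘(ℝ, E) φ (φ.symm z) (W (φ.symm z)) := fun W z hz =>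
    congrArg (fun L => L (W (φ.symm z)))
      (ContinuousLinearMap.inverse_equiv (hM.symm.mfderiv hz))
  have hsm : ContMDiffAt 𝓘(ℝ, G) 𝓘(ℝ, E) ∞ φ.symm (φ x) :=
    (F.contMDiffOn_symm φ hφ).contMDiffAt (φ.open_target.mem_nhds hz)
  have hxx : φ.symm (φ x) = x := φ.left_inv hx
  -- In the chart a tangent field has zero transverse component near `φ x`, not only at that point,
  -- so the derivative of this component vanishes too. Naming the pullback `W'` gives it the type `G
  -- → G` that `fderiv` needs.
  have key : ∀ (W : (x : M) → TangentSpace 𝓘(ℝ, E) x), MDiffAt (T% W) x →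
      (∀ᶠ y in 𝓝 x, W y ∈ F.tangent y) → ∃ W' : G → G,
      W' = VectorField.mpullback 𝓘(ℝ, G) 𝓘(ℝ, E) φ.symm W ∧
      ∀ v, (fderiv ℝ W' (φ x) v).2 = 0 := by
    intro W hW hWt
    have hd : DifferentiableAt ℝ
        (VectorField.mpullback 𝓘(ℝ, G) 𝓘(ℝ, E) φ.symm W : G → G) (φ x) := by
      refine differentiableAt_of_mdifferentiableAt_vectorSpace ?_
      exact MDifferentiableAt.mpullback_vectorField (n := ∞) (by rwa [hxx]) hsm (hinv _ hz)
        two_le_infty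
    refine ⟨_, rfl, fun v => ?_⟩
    have hcont : Filter.Tendsto φ.symm (𝓝 (φ x)) (𝓝 x) := by
      simpa [hxx] using hsm.continuousAt.tendsto
    have hev : (fun z => (VectorField.mpullback 𝓘(ℝ, G) 𝓘(ℝ, E) φ.symm W z : G).2) =ᶠ[𝓝 (φ x)]
        fun _ => (0 : EuclideanSpace ℝ (Fin q)) := by
      filter_upwards [hcont hWt, φ.open_target.mem_nhds hz] with z hzt hz'
      rw [hpull W z hz']
      exact (F.mem_tangent_iff hφ (φ.map_target hz') _).1 hzt
    have h1 := hd.hasFDerivAt.snd.congr_of_eventuallyEq hev.symm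
    exact congrArg (fun L => L v) (h1.unique (hasFDerivAt_const _ _))
  rw [F.mem_tangent_iff hφ hx]
  obtain ⟨U', hU', hU2⟩ := key U hU hUt
  obtain ⟨V', hV', hV2⟩ := key V hV hVt
  -- By naturality dφ sends [U, V] to DV'(U') − DU'(V'), and both terms have zero transverse
  -- component.
  have hnat := VectorField.mpullback_mlieBracket (n := ∞) (I := 𝓘(ℝ, G)) (I' := 𝓘(ℝ, E))
    (f := φ.symm) (x₀ := φ x) (V := U) (W := V) (by rwa [hxx]) (by rwa [hxx]) hsm
    (by simpa using two_le_infty)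
  have hlie := mlieBracket_eq_lieBracket (E := G) U' V'
  rw [hpull _ _ hz, hxx, ← hU', ← hV', hlie] at hnat
  rw [hnat, VectorField.lieBracket]
  change (fderiv ℝ V' (φ x) (U' (φ x))).2 - (fderiv ℝ U' (φ x) (V' (φ x))).2 = 0
  rw [hU2, hV2, sub_zero]

end Tangent

/-! ### The orthogonal splitting -/

section Metric

variable {E : Type*} [NormedAddCommGroup E] [NormedSpace ℝ E]
  {M : Type*} [TopologicalSpace M] [ChartedSpace E M]
  {p q : ℕ} (F : Foliation E M p q)

theorem mvfderiv_congr {x : M} {h k : M → ℝ} (hk : h =ᶠ[𝓝 x] k) :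
    mvfderiv 𝓘(ℝ, E) h x = mvfderiv 𝓘(ℝ, E) k x :=
  hk.mfderiv_eq

variable [IsManifold 𝓘(ℝ, E) ∞ M]
  (g : ContMDiffRiemannianMetric 𝓘(ℝ, E) ∞ E (fun x : M => TangentSpace 𝓘(ℝ, E) x))
  {x : M}

theorem mdifferentiableAt_inner {A B : (x : M) → TangentSpace 𝓘(ℝ, E) x}
    (hA : MDiffAt (T% A) x) (hB : MDiffAt (T% B) x) :
    MDiffAt (fun y => g.inner y (A y) (B y)) x := by
  let _ : RiemannianBundle (fun x : M => TangentSpace 𝓘(ℝ, E) x) := ⟨g.toRiemannianMetric⟩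
  have : IsContMDiffRiemannianBundle 𝓘(ℝ, E) 1 E (fun x : M => TangentSpace 𝓘(ℝ, E) x) :=
    .of_le (n := ∞) (by simp)
  exact MDifferentiableAt.inner_bundle (F := E) (E := fun x : M => TangentSpace 𝓘(ℝ, E) x)
    (b := fun x => x) (v := A) (w := B) hA hB

theorem inner_normal_tangent {v w : TangentSpace 𝓘(ℝ, E) x} (hv : v ∈ F.normal g x)
    (hw : w ∈ F.tangent x) : g.inner x v w = 0 := by
  rw [g.symm]; exact hv w hw

variable [FiniteDimensional ℝ E]

theorem inner_projTangent_tangent (v : TangentSpace 𝓘(ℝ, E) x) {w : TangentSpace 𝓘(ℝ, E) x}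
    (hw : w ∈ F.tangent x) : g.inner x (F.projTangent g x v) w = g.inner x v w := by
  conv_rhs => rw [← F.projTangent_add_projNormal g x v]
  rw [map_add, add_apply, F.inner_normal_tangent g (F.projNormal_mem g x v) hw, add_zero]

theorem inner_projNormal_tangent (v : TangentSpace 𝓘(ℝ, E) x) {w : TangentSpace 𝓘(ℝ, E) x}
    (hw : w ∈ F.tangent x) : g.inner x (F.projNormal g x v) w = 0 :=
  F.inner_normal_tangent g (F.projNormal_mem g x v) hw

theorem inner_projTangent_normal (v : TangentSpace 𝓘(ℝ, E) x) {w : TangentSpace 𝓘(ℝ, E) x}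
    (hw : w ∈ F.normal g x) : g.inner x (F.projTangent g x v) w = 0 :=
  hw _ (F.projTangent_mem g x v)

theorem inner_projNormal_normal (v : TangentSpace 𝓘(ℝ, E) x) {w : TangentSpace 𝓘(ℝ, E) x}
    (hw : w ∈ F.normal g x) : g.inner x (F.projNormal g x v) w = g.inner x v w := by
  conv_rhs => rw [← F.projTangent_add_projNormal g x v]
  rw [map_add, add_apply, F.inner_projTangent_normal g v hw, zero_add]

theorem projNormal_of_mem_normal {v : TangentSpace 𝓘(ℝ, E) x} (hv : v ∈ F.normal g x) :
    F.projNormal g x v = v := by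
  have h := F.projTangent_add_projNormal g x v
  rwa [F.projTangent_of_mem_normal g hv, zero_add] at h

theorem projTangent_of_mem_tangent {v : TangentSpace 𝓘(ℝ, E) x} (hv : v ∈ F.tangent x) :
    F.projTangent g x v = v := by
  let _ : RiemannianBundle (fun x : M => TangentSpace 𝓘(ℝ, E) x) := ⟨g.toRiemannianMetric⟩
  exact Submodule.starProjection_eq_self_iff.2 hv

theorem projNormal_of_mem_tangent {v : TangentSpace 𝓘(ℝ, E) x} (hv : v ∈ F.tangent x) :
    F.projNormal g x v = 0 := by
  have h := F.projTangent_add_projNormal g x v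
  rwa [F.projTangent_of_mem_tangent g hv, add_eq_left] at h

/-- A vector is determined by its inner products with tangent and with normal vectors. -/
theorem eq_of_inner_eq {v w : TangentSpace 𝓘(ℝ, E) x}
    (ht : ∀ u ∈ F.tangent x, g.inner x v u = g.inner x w u)
    (hn : ∀ u ∈ F.normal g x, g.inner x v u = g.inner x w u) : v = w := by
  by_contra hne
  refine (g.pos x (v - w) (sub_ne_zero.2 hne)).ne' ?_
  have h : ∀ u, g.inner x (v - w) u = 0 := fun u => by
    rw [← F.projTangent_add_projNormal g x u, map_add]
    simp only [map_sub, sub_apply, ht _ (F.projTangent_mem g x u), hn _ (F.projNormal_mem g x u),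
      sub_self, add_zero]
  exact h _

/-- The Koszul formula needs fields as test objects. Projecting an arbitrary local extension keeps
the field in the distribution at every point, so that its inner products with normal fields vanish
identically. -/
theorem exists_extend_tangent (g : ContMDiffRiemannianMetric 𝓘(ℝ, E) ∞ E
    (fun x : M => TangentSpace 𝓘(ℝ, E) x)) {w : TangentSpace 𝓘(ℝ, E) x} (hw : w ∈ F.tangent x) :
    ∃ W : (x : M) → TangentSpace 𝓘(ℝ, E) x,
      MDiffAt (T% W) x ∧ (∀ y, W y ∈ F.tangent y) ∧ W x = w :=
  ⟨fun y => F.projTangent g y (FiberBundle.extend E w y),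
    F.mdifferentiableAt_projTangent g (FiberBundle.mdifferentiableAt_extend 𝓘(ℝ, E) E w),
    fun _ => F.projTangent_mem g _ _, by
      simp only [FiberBundle.extend_apply_self, F.projTangent_of_mem_tangent g hw]⟩

theorem exists_extend_normal {w : TangentSpace 𝓘(ℝ, E) x} (hw : w ∈ F.normal g x) :
    ∃ W : (x : M) → TangentSpace 𝓘(ℝ, E) x,
      MDiffAt (T% W) x ∧ (∀ y, W y ∈ F.normal g y) ∧ W x = w :=
  ⟨fun y => F.projNormal g y (FiberBundle.extend E w y),
    F.mdifferentiableAt_projNormal g (FiberBundle.mdifferentiableAt_extend 𝓘(ℝ, E) E w),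
    fun _ => F.projNormal_mem g _ _, by
      simp only [FiberBundle.extend_apply_self, F.projNormal_of_mem_normal g hw]⟩

/-! ### The warped metric with one argument in a distribution -/

section Warped

variable (f : M → ℝ)

/-- The other argument may be arbitrary, since its normal part is orthogonal to `w` for both
metrics. This matters for brackets, which in general lie in neither distribution. -/
theorem warpedInner_tangent (v : TangentSpace 𝓘(ℝ, E) x) {w : TangentSpace 𝓘(ℝ, E) x}
    (hw : w ∈ F.tangent x) : F.warpedInner g f x v w = f x ^ 2 * g.inner x v w := by
  rw [warpedInner_apply, F.projNormal_of_mem_tangent g hw, F.projTangent_of_mem_tangent g hw,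
    F.inner_projTangent_tangent g v hw, map_zero, add_zero]

theorem warpedInner_normal (v : TangentSpace 𝓘(ℝ, E) x) {w : TangentSpace 𝓘(ℝ, E) x}
    (hw : w ∈ F.normal g x) : F.warpedInner g f x v w = g.inner x v w := by
  rw [warpedInner_apply, F.projNormal_of_mem_normal g hw, F.projTangent_of_mem_normal g hw,
    F.inner_projNormal_normal g v hw, map_zero, mul_zero, zero_add]

end Warped

/-! ### Derivatives of inner products -/

section Derivatives

variable {A B : (x : M) → TangentSpace 𝓘(ℝ, E) x} (v : TangentSpace 𝓘(ℝ, E) x)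

theorem mvfderiv_inner_tangent_normal (hA : ∀ᶠ y in 𝓝 x, A y ∈ F.tangent y)
    (hB : ∀ᶠ y in 𝓝 x, B y ∈ F.normal g y) :
    mvfderiv 𝓘(ℝ, E) (fun y => g.inner y (A y) (B y)) x v = 0 := by
  rw [mvfderiv_congr (k := fun _ => 0) (by filter_upwards [hA, hB] with y ha hb using hb _ ha),
    mvfderiv_const]
  rfl

theorem mvfderiv_inner_normal_tangent (hA : ∀ᶠ y in 𝓝 x, A y ∈ F.normal g y)
    (hB : ∀ᶠ y in 𝓝 x, B y ∈ F.tangent y) :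
    mvfderiv 𝓘(ℝ, E) (fun y => g.inner y (A y) (B y)) x v = 0 := by
  simp only [g.symm _ (A _)]
  exact F.mvfderiv_inner_tangent_normal g v hB hA

theorem mvfderiv_warpedInner_normal (f : M → ℝ) (hB : ∀ᶠ y in 𝓝 x, B y ∈ F.normal g y) :
    mvfderiv 𝓘(ℝ, E) (fun y => F.warpedInner g f y (A y) (B y)) x v =
      mvfderiv 𝓘(ℝ, E) (fun y => g.inner y (A y) (B y)) x v := by
  rw [mvfderiv_congr]
  filter_upwards [hB] with y hb using F.warpedInner_normal g f _ hb

theorem mvfderiv_warpedInner_tangent {f : M → ℝ} (hf : MDiffAt f x) (hA : MDiffAt (T% A) x)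
    (hB : MDiffAt (T% B) x) (hBt : ∀ᶠ y in 𝓝 x, B y ∈ F.tangent y) :
    mvfderiv 𝓘(ℝ, E) (fun y => F.warpedInner g f y (A y) (B y)) x v =
      f x ^ 2 * mvfderiv 𝓘(ℝ, E) (fun y => g.inner y (A y) (B y)) x v +
      mvfderiv 𝓘(ℝ, E) (fun y => f y ^ 2) x v * g.inner x (A x) (B x) := by
  rw [mvfderiv_congr (k := fun y => f y ^ 2 * g.inner y (A y) (B y))
    (by filter_upwards [hBt] with y hb using F.warpedInner_tangent g f _ hb),
    mvfderiv_fun_mul (f := fun y => f y ^ 2) (hf.pow 2) (mdifferentiableAt_inner g hA hB)]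
  simp only [add_apply, _root_.smul_apply, smul_eq_mul]
  ring

end Derivatives

/-! ### The integrability tensor against tangent and normal vectors -/

section Integrability

variable {g} {cov : CovariantDerivative 𝓘(ℝ, E) E (fun x : M => TangentSpace 𝓘(ℝ, E) x)}
  {X Y : (x : M) → TangentSpace 𝓘(ℝ, E) x}

theorem integrabilityForm_apply (hX : MDiffAt (T% X) x) (hY : MDiffAt (T% Y) x) :
    F.integrabilityForm g cov x (X x) (Y x) = F.integrabilityAux g cov X Y x := by
  unfold integrabilityForm
  exact TensorialAt.mkHom₂_apply _ _ hX hY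

theorem integrabilityForm_mem_tangent (u v : TangentSpace 𝓘(ℝ, E) x) :
    F.integrabilityForm g cov x u v ∈ F.tangent x :=
  F.projTangent_mem g x _

/-- Near the point the projections fix both fields and covariant derivatives are local, so
torsion-freeness turns the antisymmetrized derivative into a bracket. In this form A can be matched
with the Koszul formula. -/
theorem integrabilityForm_normal (h : IsLeviCivita g cov) (hX : MDiffAt (T% X) x)
    (hY : MDiffAt (T% Y) x) (hXn : ∀ᶠ y in 𝓝 x, X y ∈ F.normal g y)
    (hYn : ∀ᶠ y in 𝓝 x, Y y ∈ F.normal g y) :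
    F.integrabilityForm g cov x (X x) (Y x) =
      (1 / 2 : ℝ) • F.projTangent g x (VectorField.mlieBracket 𝓘(ℝ, E) X Y x) := by
  have hc : ∀ Z : (x : M) → TangentSpace 𝓘(ℝ, E) x, MDiffAt (T% Z) x →
      (∀ᶠ y in 𝓝 x, Z y ∈ F.normal g y) → cov (fun y => F.projNormal g y (Z y)) x = cov Z x :=
    fun Z hZ hZn => cov.isCovariantDerivativeOn.congr_of_eventuallyEq
      (F.mdifferentiableAt_projNormal g hZ) hZ Filter.univ_mem
      (hZn.mono fun y hy => F.projNormal_of_mem_normal g hy)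
  rw [F.integrabilityForm_apply hX hY, integrabilityAux, hc X hX hXn, hc Y hY hYn,
    F.projNormal_of_mem_normal g hXn.self_of_nhds, F.projNormal_of_mem_normal g hYn.self_of_nhds,
    ← smul_sub, map_smul, h.sub_swap hX hY]

/-- By tensoriality `v` may be extended to a tangent field, whose normal projection is the zero
field. -/
theorem integrabilityForm_tangent_right (u : TangentSpace 𝓘(ℝ, E) x)
    {v : TangentSpace 𝓘(ℝ, E) x} (hv : v ∈ F.tangent x) :
    F.integrabilityForm g cov x u v = 0 := by
  obtain ⟨V, hV, hVt, rfl⟩ := F.exists_extend_tangent g hv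
  have hU := FiberBundle.mdifferentiableAt_extend 𝓘(ℝ, E) E u
  have h := F.integrabilityForm_apply (g := g) (cov := cov) hU hV
  rw [FiberBundle.extend_apply_self] at h
  have h0 : (fun y => F.projNormal g y (V y)) = 0 :=
    funext fun y => F.projNormal_of_mem_tangent g (hVt y)
  rw [h, integrabilityAux, h0, F.projNormal_of_mem_tangent g (hVt x), cov.zero]
  simp

/-- The adjoint is replaced by its defining property. The evaluations below follow because the
bilinear form has tangent values and vanishes when its second argument is tangent. -/
theorem inner_integrabilityTensor (u v w : TangentSpace 𝓘(ℝ, E) x) :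
    g.inner x (F.integrabilityTensor g cov x u v) w =
      g.inner x (F.integrabilityForm g cov x u v) w -
      g.inner x v (F.integrabilityForm g cov x u w) := by
  let _ : RiemannianBundle (fun x : M => TangentSpace 𝓘(ℝ, E) x) := ⟨g.toRiemannianMetric⟩
  have : CompleteSpace (TangentSpace 𝓘(ℝ, E) x) := FiniteDimensional.complete ℝ _
  rw [integrabilityTensor, map_sub, sub_apply]
  congr 1
  exact ContinuousLinearMap.adjoint_inner_left (F.integrabilityForm g cov x u) w v

theorem inner_integrabilityTensor_normal_tangent (h : IsLeviCivita g cov) (hX : MDiffAt (T% X) x)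
    (hY : MDiffAt (T% Y) x) (hXn : ∀ᶠ y in 𝓝 x, X y ∈ F.normal g y)
    (hYn : ∀ᶠ y in 𝓝 x, Y y ∈ F.normal g y) {w : TangentSpace 𝓘(ℝ, E) x} (hw : w ∈ F.tangent x) :
    g.inner x (F.integrabilityTensor g cov x (X x) (Y x)) w =
      1 / 2 * g.inner x (VectorField.mlieBracket 𝓘(ℝ, E) X Y x) w := by
  rw [inner_integrabilityTensor, F.integrabilityForm_tangent_right _ hw,
    F.integrabilityForm_normal h hX hY hXn hYn, map_smul, _root_.smul_apply,
    F.inner_projTangent_tangent g _ hw, map_zero, sub_zero, smul_eq_mul]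

theorem inner_integrabilityTensor_normal_normal (u : TangentSpace 𝓘(ℝ, E) x)
    {v w : TangentSpace 𝓘(ℝ, E) x} (hv : v ∈ F.normal g x) (hw : w ∈ F.normal g x) :
    g.inner x (F.integrabilityTensor g cov x u v) w = 0 := by
  rw [inner_integrabilityTensor, hw _ (F.integrabilityForm_mem_tangent _ _),
    F.inner_normal_tangent g hv (F.integrabilityForm_mem_tangent _ _), sub_zero]

theorem inner_integrabilityTensor_tangent_tangent (u : TangentSpace 𝓘(ℝ, E) x)
    {v w : TangentSpace 𝓘(ℝ, E) x} (hv : v ∈ F.tangent x) (hw : w ∈ F.tangent x) :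
    g.inner x (F.integrabilityTensor g cov x u v) w = 0 := by
  rw [inner_integrabilityTensor, F.integrabilityForm_tangent_right _ hv,
    F.integrabilityForm_tangent_right _ hw, map_zero, map_zero, zero_apply, sub_zero]

theorem inner_integrabilityTensor_tangent_normal (h : IsLeviCivita g cov) (hX : MDiffAt (T% X) x)
    (hY : MDiffAt (T% Y) x) (hXn : ∀ᶠ y in 𝓝 x, X y ∈ F.normal g y)
    (hYn : ∀ᶠ y in 𝓝 x, Y y ∈ F.normal g y) {u : TangentSpace 𝓘(ℝ, E) x} (hu : u ∈ F.tangent x) :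
    g.inner x (F.integrabilityTensor g cov x (X x) u) (Y x) =
      -(1 / 2 * g.inner x (VectorField.mlieBracket 𝓘(ℝ, E) X Y x) u) := by
  rw [inner_integrabilityTensor, F.integrabilityForm_tangent_right _ hu,
    F.integrabilityForm_normal h hX hY hXn hYn, map_zero, zero_apply, zero_sub, map_smul, g.symm,
    F.inner_projTangent_tangent g _ hu, smul_eq_mul]

end Integrability

/-! ### Comparison of the two Koszul formulas -/

section Warped

variable {g} {f : M → ℝ} {hf : F.IsWarpingFunction f}
  {nabla nablaf : CovariantDerivative 𝓘(ℝ, E) E (fun x : M => TangentSpace 𝓘(ℝ, E) x)}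
  {X Y U V : (x : M) → TangentSpace 𝓘(ℝ, E) x}

theorem warped_normal_normal (h : IsLeviCivita g nabla)
    (h' : IsLeviCivita (F.warpedMetric g f hf) nablaf)
    (hX : MDiffAt (T% X) x) (hY : MDiffAt (T% Y) x)
    (hXn : ∀ᶠ y in 𝓝 x, X y ∈ F.normal g y) (hYn : ∀ᶠ y in 𝓝 x, Y y ∈ F.normal g y) :
    nablaf Y x (X x) =
      F.projNormal g x (nabla Y x (X x)) + (1 / f x ^ 2) • F.projTangent g x (nabla Y x (X x))
        - ((1 - f x ^ 2) / f x ^ 2) • F.integrabilityTensor g nabla x (X x) (Y x) := by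
  have hf0 := (hf.pos x).ne'
  have hfd : MDiffAt f x := hf.contMDiff.contMDiffAt.mdifferentiableAt (by simp)
  have hXx := hXn.self_of_nhds
  have hYx := hYn.self_of_nhds
  refine F.eq_of_inner_eq g (fun w hw => ?_) fun w hw => ?_
  · obtain ⟨W, hW, hWt, rfl⟩ := F.exists_extend_tangent g hw
    have hWt' := Filter.Eventually.of_forall (f := 𝓝 x) hWt
    have k := h.koszul hX hY hW
    have k' := h'.koszul hX hY hW
    -- Unfolding exposes `warpedInner`, so that each term of the second Koszul formula can be
    -- rewritten by the side that holds a tangent or normal field.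
    simp only [warpedMetric] at k'
    rw [F.mvfderiv_warpedInner_tangent g _ hfd hY hW hWt',
      F.mvfderiv_inner_normal_tangent g _ hYn hWt', F.inner_normal_tangent g hYx hw,
      F.mvfderiv_warpedInner_normal g _ f hXn, F.mvfderiv_inner_tangent_normal g _ hWt' hXn,
      F.mvfderiv_warpedInner_normal g _ f hYn, F.warpedInner_tangent g f _ hw,
      F.warpedInner_tangent g f _ hw, F.warpedInner_normal g f _ hXx,
      F.warpedInner_normal g f _ hYx] at k'
    rw [F.mvfderiv_inner_normal_tangent g _ hYn hWt',
      F.mvfderiv_inner_tangent_normal g _ hWt' hXn] at k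
    simp only [map_add, map_sub, map_smul, add_apply, sub_apply, _root_.smul_apply, smul_eq_mul,
      F.inner_projTangent_tangent g _ hw, F.inner_projNormal_tangent g _ hw,
      F.inner_integrabilityTensor_normal_tangent h hX hY hXn hYn hw]
    field_simp
    -- On the right-hand sides only ⟨[X, Y], W⟩ acquires the factor f², so 2f²⟨∇^f_X Y, W⟩ − 2⟨∇_X
    -- Y, W⟩ = (f² − 1)⟨[X, Y], W⟩, which is 2(f² − 1)⟨A(X, Y), W⟩.
    linear_combination k' - k
  · obtain ⟨Z, hZ, hZn, rfl⟩ := F.exists_extend_normal g hw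
    have hZn' := Filter.Eventually.of_forall (f := 𝓝 x) hZn
    have k := h.koszul hX hY hZ
    have k' := h'.koszul hX hY hZ
    simp only [warpedMetric] at k'
    rw [F.mvfderiv_warpedInner_normal g _ f hZn', F.mvfderiv_warpedInner_normal g _ f hXn,
      F.mvfderiv_warpedInner_normal g _ f hYn, F.warpedInner_normal g f _ hw,
      F.warpedInner_normal g f _ hw, F.warpedInner_normal g f _ hXx,
      F.warpedInner_normal g f _ hYx] at k'
    simp only [map_add, map_sub, map_smul, add_apply, sub_apply, _root_.smul_apply, smul_eq_mul,
      F.inner_projTangent_normal g _ hw, F.inner_projNormal_normal g _ hw,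
      F.inner_integrabilityTensor_normal_normal _ hYx hw]
    -- Against a normal field no term changes, and A(X, Y) has no normal part.
    linear_combination (k' - k) / 2

theorem warped_tangent_tangent (h : IsLeviCivita g nabla)
    (h' : IsLeviCivita (F.warpedMetric g f hf) nablaf)
    (hU : MDiffAt (T% U) x) (hV : MDiffAt (T% V) x)
    (hUt : ∀ᶠ y in 𝓝 x, U y ∈ F.tangent y) (hVt : ∀ᶠ y in 𝓝 x, V y ∈ F.tangent y) :
    nablaf V x (U x) =
      F.projTangent g x (nabla V x (U x)) + f x ^ 2 • F.projNormal g x (nabla V x (U x))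
        - (1 / 2 * g.inner x (U x) (V x)) • gradient g (fun y => f y ^ 2) x := by
  have hf0 := (hf.pos x).ne'
  have hfd : MDiffAt f x := hf.contMDiff.contMDiffAt.mdifferentiableAt (by simp)
  have hUx := hUt.self_of_nhds
  have hVx := hVt.self_of_nhds
  have hdf : ∀ u ∈ F.tangent x, mvfderiv 𝓘(ℝ, E) (fun y => f y ^ 2) x u = 0 := fun u hu =>
    F.mvfderiv_eq_zero_of_mem_tangent (h := fun y => f y ^ 2) (hfd.pow 2)
      (fun y z hz => congrArg (· ^ 2) (hf.eq_of_mem_leaf y z hz)) hu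
  refine F.eq_of_inner_eq g (fun w hw => ?_) fun w hw => ?_
  · obtain ⟨W, hW, hWt, rfl⟩ := F.exists_extend_tangent g hw
    have hWt' := Filter.Eventually.of_forall (f := 𝓝 x) hWt
    have k := h.koszul hU hV hW
    have k' := h'.koszul hU hV hW
    simp only [warpedMetric] at k'
    rw [F.mvfderiv_warpedInner_tangent g _ hfd hV hW hWt',
      F.mvfderiv_warpedInner_tangent g _ hfd hW hU hUt,
      F.mvfderiv_warpedInner_tangent g _ hfd hU hV hVt, hdf _ hUx, hdf _ hVx, hdf _ hw,
      F.warpedInner_tangent g f _ hw, F.warpedInner_tangent g f _ hw,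
      F.warpedInner_tangent g f _ hUx, F.warpedInner_tangent g f _ hVx] at k'
    simp only [map_add, map_sub, map_smul, add_apply, sub_apply, _root_.smul_apply, smul_eq_mul,
      F.inner_projTangent_tangent g _ hw, F.inner_projNormal_tangent g _ hw, inner_gradient,
      hdf _ hw]
    refine mul_left_cancel₀ (pow_ne_zero 2 hf0) ?_
    -- With three tangent fields the derivatives of f² vanish and the whole formula is multiplied by
    -- f².
    linear_combination (k' - f x ^ 2 * k) / 2
  · obtain ⟨Z, hZ, hZn, rfl⟩ := F.exists_extend_normal g hw
    have hZn' := Filter.Eventually.of_forall (f := 𝓝 x) hZn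
    have k := h.koszul hU hV hZ
    have k' := h'.koszul hU hV hZ
    -- This is the one term that would enter with factor 1 instead of f²; involutivity removes it.
    have hb : g.inner x (VectorField.mlieBracket 𝓘(ℝ, E) U V x) (Z x) = 0 :=
      hw _ (F.mlieBracket_mem_tangent hU hV hUt hVt)
    simp only [warpedMetric] at k'
    rw [F.mvfderiv_warpedInner_normal g _ f hZn', F.mvfderiv_inner_tangent_normal g _ hVt hZn',
      F.mvfderiv_warpedInner_tangent g _ hfd hZ hU hUt,
      F.mvfderiv_inner_normal_tangent g _ hZn' hUt, F.inner_normal_tangent g hw hUx,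
      F.mvfderiv_warpedInner_tangent g _ hfd hU hV hVt,
      F.warpedInner_normal g f _ hw, F.warpedInner_normal g f _ hw,
      F.warpedInner_tangent g f _ hUx, F.warpedInner_tangent g f _ hVx, hb] at k'
    rw [F.mvfderiv_inner_tangent_normal g _ hVt hZn',
      F.mvfderiv_inner_normal_tangent g _ hZn' hUt, hb] at k
    simp only [map_add, map_sub, map_smul, add_apply, sub_apply, _root_.smul_apply, smul_eq_mul,
      F.inner_projTangent_normal g _ hw, F.inner_projNormal_normal g _ hw, inner_gradient]
    -- The product rule for −Z(f²⟨U, V⟩) leaves −Z(f²)⟨U, V⟩ beside f² times the formula for g; this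
    -- is the gradient term.
    linear_combination (k' - f x ^ 2 * k) / 2

theorem warped_normal_tangent (h : IsLeviCivita g nabla)
    (h' : IsLeviCivita (F.warpedMetric g f hf) nablaf)
    (hX : MDiffAt (T% X) x) (hU : MDiffAt (T% U) x)
    (hXn : ∀ᶠ y in 𝓝 x, X y ∈ F.normal g y) (hUt : ∀ᶠ y in 𝓝 x, U y ∈ F.tangent y) :
    nablaf U x (X x) =
      nabla U x (X x)
        + (1 / 2 * (mvfderiv 𝓘(ℝ, E) (fun y => f y ^ 2) x (X x) / f x ^ 2)) • U x
        - (1 - f x ^ 2) • F.integrabilityTensor g nabla x (X x) (U x) := by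
  have hf0 := (hf.pos x).ne'
  have hfd : MDiffAt f x := hf.contMDiff.contMDiffAt.mdifferentiableAt (by simp)
  have hXx := hXn.self_of_nhds
  have hUx := hUt.self_of_nhds
  refine F.eq_of_inner_eq g (fun w hw => ?_) fun w hw => ?_
  · obtain ⟨W, hW, hWt, rfl⟩ := F.exists_extend_tangent g hw
    have hWt' := Filter.Eventually.of_forall (f := 𝓝 x) hWt
    have k := h.koszul hX hU hW
    have k' := h'.koszul hX hU hW
    have hb : g.inner x (VectorField.mlieBracket 𝓘(ℝ, E) U W x) (X x) = 0 :=
      hXx _ (F.mlieBracket_mem_tangent hU hW hUt hWt')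
    simp only [warpedMetric] at k'
    rw [F.mvfderiv_warpedInner_tangent g _ hfd hU hW hWt',
      F.mvfderiv_warpedInner_normal g _ f hXn, F.mvfderiv_inner_tangent_normal g _ hWt' hXn,
      F.mvfderiv_warpedInner_tangent g _ hfd hX hU hUt,
      F.mvfderiv_inner_normal_tangent g _ hXn hUt, F.inner_normal_tangent g hXx hUx,
      F.warpedInner_tangent g f _ hw, F.warpedInner_tangent g f _ hw,
      F.warpedInner_normal g f _ hXx, F.warpedInner_tangent g f _ hUx, hb] at k'
    rw [F.mvfderiv_inner_tangent_normal g _ hWt' hXn,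
      F.mvfderiv_inner_normal_tangent g _ hXn hUt, hb] at k
    simp only [map_add, map_sub, map_smul, add_apply, sub_apply, _root_.smul_apply, smul_eq_mul,
      F.inner_integrabilityTensor_tangent_tangent _ hUx hw]
    field_simp
    -- Everything scales by f² except for the extra X(f²)⟨U, W⟩ from differentiating f²⟨U, W⟩ along
    -- X.
    linear_combination k' - f x ^ 2 * k
  · obtain ⟨Z, hZ, hZn, rfl⟩ := F.exists_extend_normal g hw
    have hZn' := Filter.Eventually.of_forall (f := 𝓝 x) hZn
    have k := h.koszul hX hU hZ
    have k' := h'.koszul hX hU hZ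
    have hs : g.inner x (VectorField.mlieBracket 𝓘(ℝ, E) Z X x) (U x) =
        -g.inner x (VectorField.mlieBracket 𝓘(ℝ, E) X Z x) (U x) := by
      rw [VectorField.mlieBracket_swap_apply, map_neg, neg_apply]
    simp only [warpedMetric] at k'
    rw [F.mvfderiv_warpedInner_normal g _ f hZn', F.mvfderiv_warpedInner_normal g _ f hXn,
      F.mvfderiv_warpedInner_tangent g _ hfd hX hU hUt,
      F.mvfderiv_inner_normal_tangent g _ hXn hUt, F.inner_normal_tangent g hXx hUx,
      F.warpedInner_normal g f _ hw, F.warpedInner_normal g f _ hw,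
      F.warpedInner_normal g f _ hXx, F.warpedInner_tangent g f _ hUx, hs] at k'
    rw [F.mvfderiv_inner_normal_tangent g _ hXn hUt, hs] at k
    simp only [map_add, map_sub, map_smul, add_apply, sub_apply, _root_.smul_apply, smul_eq_mul,
      F.inner_integrabilityTensor_tangent_normal h hX hZ hXn hZn' hUx, hw _ hUx]
    -- Only ⟨[Z, X], U⟩ is scaled; its surplus (1 − f²)⟨[X, Z], U⟩ equals −2(1 − f²)⟨A(X, U), Z⟩.
    linear_combination (k' - k) / 2

/-- ∇^f_X U − ∇^f_U X and ∇_X U − ∇_U X both equal [X, U], so the correction terms are those of the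
preceding formula. -/
theorem warped_tangent_normal (h : IsLeviCivita g nabla)
    (h' : IsLeviCivita (F.warpedMetric g f hf) nablaf)
    (hX : MDiffAt (T% X) x) (hU : MDiffAt (T% U) x)
    (hXn : ∀ᶠ y in 𝓝 x, X y ∈ F.normal g y) (hUt : ∀ᶠ y in 𝓝 x, U y ∈ F.tangent y) :
    nablaf X x (U x) =
      nabla X x (U x)
        + (1 / 2 * (mvfderiv 𝓘(ℝ, E) (fun y => f y ^ 2) x (X x) / f x ^ 2)) • U x
        - (1 - f x ^ 2) • F.integrabilityTensor g nabla x (X x) (U x) := by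
  have e := (h'.sub_swap hX hU).trans (h.sub_swap hX hU).symm
  rw [F.warped_normal_tangent h h' hX hU hXn hUt] at e
  rw [← sub_eq_zero] at e ⊢
  rw [← neg_eq_zero, ← e]
  abel

end Warped

end Metric
end Foliation
end WarpedFoliation

/-! ### The theorem for smooth fields on an open set -/

open WarpedFoliation in
theorem mainTheorem1
    {E : Type*} [NormedAddCommGroup E] [NormedSpace ℝ E] [FiniteDimensional ℝ E]
    {M : Type*} [TopologicalSpace M] [ChartedSpace E M] [IsManifold 𝓘(ℝ, E) ∞ M]
    {p q : ℕ} (F : Foliation E M p q)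
    (g : ContMDiffRiemannianMetric 𝓘(ℝ, E) ∞ E (fun x : M => TangentSpace 𝓘(ℝ, E) x))
    (f : M → ℝ) (hf : F.IsWarpingFunction f)
    (nabla nablaf : CovariantDerivative 𝓘(ℝ, E) E (fun x : M => TangentSpace 𝓘(ℝ, E) x))
    (hnabla : IsLeviCivita g nabla) (hnablaf : IsLeviCivita (F.warpedMetric g f hf) nablaf)
    -- vector fields on an open set `Ω`, with `X`, `Y` orthogonal and `U`, `V` tangent to `F`
    (Ω : Set M) (hΩ : IsOpen Ω) (X Y U V : (x : M) → TangentSpace 𝓘(ℝ, E) x)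
    (hX : CMDiff[Ω] ∞ (T% X)) (hY : CMDiff[Ω] ∞ (T% Y))
    (hU : CMDiff[Ω] ∞ (T% U)) (hV : CMDiff[Ω] ∞ (T% V))
    (hXn : ∀ y ∈ Ω, X y ∈ F.normal g y) (hYn : ∀ y ∈ Ω, Y y ∈ F.normal g y)
    (hUt : ∀ y ∈ Ω, U y ∈ F.tangent y) (hVt : ∀ y ∈ Ω, V y ∈ F.tangent y)
    (x : M) (hx : x ∈ Ω) :
    nablaf Y x (X x) =
        F.projNormal g x (nabla Y x (X x)) + (1 / f x ^ 2) • F.projTangent g x (nabla Y x (X x))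
          - ((1 - f x ^ 2) / f x ^ 2) • F.integrabilityTensor g nabla x (X x) (Y x) ∧
    nablaf V x (U x) =
        F.projTangent g x (nabla V x (U x)) + f x ^ 2 • F.projNormal g x (nabla V x (U x))
          - (1 / 2 * g.inner x (U x) (V x)) • gradient g (fun y => f y ^ 2) x ∧
    nablaf U x (X x) =
        nabla U x (X x)
          + (1 / 2 * (mvfderiv 𝓘(ℝ, E) (fun y => f y ^ 2) x (X x) / f x ^ 2)) • U x
          - (1 - f x ^ 2) • F.integrabilityTensor g nabla x (X x) (U x) ∧
    nablaf X x (U x) =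
        nabla X x (U x)
          + (1 / 2 * (mvfderiv 𝓘(ℝ, E) (fun y => f y ^ 2) x (X x) / f x ^ 2)) • U x
          - (1 - f x ^ 2) • F.integrabilityTensor g nabla x (X x) (U x) := by
  -- The pointwise formulas only need differentiability at `x` and membership in the distributions
  -- near `x`; openness of `Ω` provides both.
  have hΩx := hΩ.mem_nhds hx
  have hX' : MDiffAt (T% X) x := (hX.contMDiffAt hΩx).mdifferentiableAt (by simp)
  have hY' : MDiffAt (T% Y) x := (hY.contMDiffAt hΩx).mdifferentiableAt (by simp)
  have hU' : MDiffAt (T% U) x := (hU.contMDiffAt hΩx).mdifferentiableAt (by simp)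
  have hV' : MDiffAt (T% V) x := (hV.contMDiffAt hΩx).mdifferentiableAt (by simp)
  have hXn' := Filter.eventually_of_mem hΩx hXn
  have hYn' := Filter.eventually_of_mem hΩx hYn
  have hUt' := Filter.eventually_of_mem hΩx hUt
  have hVt' := Filter.eventually_of_mem hΩx hVt
  exact ⟨F.warped_normal_normal hnabla hnablaf hX' hY' hXn' hYn',
    F.warped_tangent_tangent hnabla hnablaf hU' hV' hUt' hVt',
    F.warped_normal_tangent hnabla hnablaf hX' hU' hXn' hUt',
    F.warped_tangent_normal hnabla hnablaf hX' hU' hXn' hUt'⟩
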